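/- Let $p$ be a prime, $a>1$, $m\ge 1$, $s>0$, let $R=GR(p^a,m)=\mathbb Z_{p^a}[x]/\langle h\rangle$ be the Galois ring ($h$ a monic basic irreducible polynomial of degree $m$), and let $g=x^{p^s}+1$ if $p$ is odd and $g=x^{2^s}-1$ if $p=2$. Put $A=R[x]/\langle g\rangle$. The Hamming weight of an element of $A$ (or of $\mathbb F_{p^m}[x]/\langle g\rangle$) is the number of nonzero coefficients of its representative of degree less than $p^s$, and $d(C)$ is the least weight of a nonzero element of the ideal $C$, with $d(0)=0$. Let $\mathcal T_m=\{0,1,\zeta,\dots,\zeta^{p^m-2}\}$, with $\zeta\in R$ a primitive $(p^m-1)$-th root of unity, be the Teichmüller set of $R$. Call $p^{j_0}f_0,\dots,p^{j_r}f_r$ (where $0\le r\le a-1$ and the $f_i$ are identified with their representatives of degree less than $p^s$) a standard generating set of an ideal $I$ of $A$ if $I=\langle p^{j_0}f_0,\dots,p^{j_r}f_r\rangle$ and 1. $0\le j_0<\dots<j_r\le a-1$; 2. every $f_i$ is monic; 3. $p^s>\deg f_0>\dots>\deg f_r$; 4. $p^{j_{i+1}}f_i\in\langle p^{j_{i+1}}f_{i+1},\dots,p^{j_r}f_r\rangle$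 in $A$ for $0\le i<r$; 5. $p^{j_0}g\in\langle p^{j_0}f_0,\dots,p^{j_r}f_r\rangle$ in $R[x]$. Then every nonzero ideal $I$ of $A$ has a standard generating set. For every standard generating set of an ideal $I$, the last generator $f_r$ has a canonical form $$f_r=\sum_{k=0}^{a-1}\beta_k\,p^k(x+1)^{i_k}\alpha_k(x)\quad\text{in }A,$$ with $\beta_k\in\mathcal T_m$, $\alpha_k\in A$ invertible, $0\le i_k<p^s$, and the exponents $i_k$ belonging to nonzero $\beta_k$ strictly decreasing in $k$. Moreover, for every such expression of $f_r$ (even if the conditions on the size and order of the $i_k$ are dropped), $\beta_0\ne0$, $i_0<p^s$ and $$d(I)=d(\langle p^{a-1}f_r\rangle)=d(\langle p^{a-1}(x+1)^{i_0}\rangle)=d\bigl(\langle (x+1)^{i_0}\rangle\subseteq \mathbb F_{p^m}[x]/\langle g\rangle\bigr),$$ and this number is given by Dinh's formula at $i=i_0$: it is - $1$ if $i=0$; - $\beta+2$ if $\beta p^{s-1}+1\le i\le(\beta+1)p^{s-1}$ with $0\le\beta\le p-2$; - $(t+1)p^k$ if $p^s-p^{s-k}+(t-1)p^{s-k-1}+1\le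 i\le p^s-p^{s-k}+tp^{s-k-1}$ with $1\le t\le p-1$, $1\le k\le s-1$ (and $0$ if $i=p^s$, which does not occur for $i=i_0$). -/

import Mathlib

open Polynomial

/-- A (monic) basic irreducible polynomial over `ℤ/p^a`: it is irreducible and its reduction
modulo `p` is irreducible over `ℤ/p`. -/
structure IsBasicIrreducible (p a : ℕ) (ha : a ≠ 0) (h : (ZMod (p ^ a))[X]) : Prop where
  monic : h.Monic
  irreducible : Irreducible h
  irreducible_reduction :
    Irreducible (h.map (ZMod.castHom (dvd_pow_self p ha) (ZMod p)))

/-- The Galois ring `GR(p^a, m) = (ℤ/p^a)[x] / ⟨h⟩`, for `h` basic irreducible of degree `m`. -/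
abbrev GaloisRing (p a : ℕ) (h : (ZMod (p ^ a))[X]) : Type :=
  AdjoinRoot h

/-- The Teichmüller set `{0, 1, ζ, …, ζ^(p^m - 2)}` of a Galois ring `R = GR(p^a, m)`, where `ζ` is
a primitive `(p^m - 1)`-th root of unity in `R` (the set does not depend on the choice of `ζ`). -/
def teichmullerSet (R : Type) [CommRing R] (p m : ℕ) : Set R :=
  {b | ∃ ζ : R, IsPrimitiveRoot ζ (p ^ m - 1) ∧
    (b = 0 ∨ ∃ k : ℕ, k < p ^ m - 1 ∧ b = ζ ^ k)}

/-- The polynomial `x^n - c`; it is `x^n + 1` for `c = -1` and `x^n - 1` for `c = 1`. -/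
noncomputable def codeModulus (R : Type) [CommRing R] (c : ℤ) (n : ℕ) : R[X] :=
  X ^ n - C (c : R)

theorem codeModulus_monic (R : Type) [CommRing R] (c : ℤ) {n : ℕ} (hn : n ≠ 0) :
    (codeModulus R c n).Monic :=
  monic_X_pow_sub_C _ hn

/-- The code ambient `R[x] / ⟨x^n - c⟩`. -/
abbrev CodeAmbient (R : Type) [CommRing R] (c : ℤ) (n : ℕ) : Type :=
  AdjoinRoot (codeModulus R c n)

/-- The residue class in `R[x] / ⟨x^n - c⟩` of a polynomial. -/
noncomputable abbrev toAmbient {R : Type} [CommRing R] (c : ℤ) (n : ℕ) (f : R[X]) :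
    CodeAmbient R c n :=
  AdjoinRoot.mk (codeModulus R c n) f

/-- The Hamming weight of an element of `R[x] / ⟨x^n - c⟩`: the number of nonzero coefficients of
its representative of degree less than `n`. -/
noncomputable def hammingWeight {R : Type} [CommRing R] {c : ℤ} {n : ℕ} (hn : n ≠ 0)
    (w : CodeAmbient R c n) : ℕ :=
  (AdjoinRoot.modByMonicHom (codeModulus_monic R c hn) w).support.card

/-- The minimum Hamming distance of a code (an ideal): the least weight of a nonzero codeword.
The zero code has distance `0`. -/
noncomputable def codeDistance {R : Type} [CommRing R] {c : ℤ} {n : ℕ} (hn : n ≠ 0)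
    (I : Ideal (CodeAmbient R c n)) : ℕ :=
  sInf {d | ∃ w ∈ I, w ≠ 0 ∧ hammingWeight hn w = d}

/-- `I = ⟨p^(j 0) f 0, …, p^(j r) f r⟩` in `R[x] / ⟨x^n - c⟩`, where the generators have the
divisibility properties of a minimal strong Gröbner basis. The `f i` are given by their
representatives of degree less than `n`. -/
structure IsStandardGeneratingSet {R : Type} [CommRing R] {c : ℤ} {n : ℕ} (p a : ℕ)
    (I : Ideal (CodeAmbient R c n)) (r : ℕ) (j : Fin (r + 1) → ℕ) (f : Fin (r + 1) → R[X]) :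
    Prop where
  r_le : r ≤ a - 1
  span_eq : I = Ideal.span (Set.range fun i => toAmbient c n ((p : R[X]) ^ j i * f i))
  j_strictMono : StrictMono j
  j_le : ∀ i, j i ≤ a - 1
  monic : ∀ i, (f i).Monic
  natDegree_lt : ∀ i, (f i).natDegree < n
  natDegree_strictAnti : StrictAnti fun i => (f i).natDegree
  chain : ∀ i : Fin r, toAmbient c n ((p : R[X]) ^ j i.succ * f i.castSucc) ∈
    Ideal.span ((fun k => toAmbient c n ((p : R[X]) ^ j k * f k)) '' Set.Ici i.succ)
  modulus_mem : (p : R[X]) ^ j 0 * codeModulus R c n ∈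
    Ideal.span (Set.range fun i => (p : R[X]) ^ j i * f i)

/-- The expression `w = ∑_{k < a} β_k p^k (x+1)^{e_k} α_k` in `R[x] / ⟨x^n - c⟩`, with each `β_k` in
the Teichmüller set of `R` and each `α_k` invertible. Only the indices `k < a` matter. -/
structure IsUnitExpansion {R : Type} [CommRing R] {c : ℤ} {n : ℕ} (p a m : ℕ)
    (w : CodeAmbient R c n) (β : ℕ → R) (e : ℕ → ℕ) (α : ℕ → CodeAmbient R c n) : Prop where
  mem_teichmuller : ∀ k < a, β k ∈ teichmullerSet R p m
  isUnit : ∀ k < a, IsUnit (α k)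
  eq_sum : w = ∑ k ∈ Finset.range a,
    toAmbient c n (C (β k) * (p : R[X]) ^ k * (X + 1) ^ e k) * α k

/-- The canonical form: such an expression with exponents less than `n` which strictly decrease
along the nonzero terms. -/
structure IsCanonicalForm {R : Type} [CommRing R] {c : ℤ} {n : ℕ} (p a m : ℕ)
    (w : CodeAmbient R c n) (β : ℕ → R) (e : ℕ → ℕ) (α : ℕ → CodeAmbient R c n) : Prop
    extends IsUnitExpansion p a m w β e α where
  exponent_lt : ∀ k < a, e k < n
  exponent_anti : ∀ k l, k < l → l < a → β k ≠ 0 → β l ≠ 0 → e l < e k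

/-- Dinh's formula: `DinhDistance p s i d` says that the formula assigns the distance `d` to the
exponent `0 ≤ i ≤ p^s`. -/
inductive DinhDistance (p s : ℕ) : ℕ → ℕ → Prop
  | zero : DinhDistance p s 0 1
  | low (i b : ℕ) (hb : b ≤ p - 2) (h₁ : b * p ^ (s - 1) + 1 ≤ i)
      (h₂ : i ≤ (b + 1) * p ^ (s - 1)) : DinhDistance p s i (b + 2)
  | high (i t k : ℕ) (ht₁ : 1 ≤ t) (ht₂ : t ≤ p - 1) (hk₁ : 1 ≤ k) (hk₂ : k ≤ s - 1)
      (h₁ : p ^ s - p ^ (s - k) + (t - 1) * p ^ (s - k - 1) + 1 ≤ i)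
      (h₂ : i ≤ p ^ s - p ^ (s - k) + t * p ^ (s - k - 1)) :
      DinhDistance p s i ((t + 1) * p ^ k)
  | top : DinhDistance p s (p ^ s) 0

/-!
Let `R` be the Galois ring, `F` its residue field, `n = p^s`, and `g` the modulus of the code
ambient `A = R[x]/⟨g⟩`. Only a few properties of `R → F` matter; they are collected in
`IsChainReduction`: the kernel is `(p)`, `p^a = 0`, and `p^(a-1)` annihilates nothing outside the
kernel. Over `F` the modulus is `(x+1)^n`, so `p` and `x + 1` are nilpotent in `A`, and a polynomial
is a unit of `A` once its reduction does not vanish at `-1`.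

*From `I` to the residue field.* A nonzero word of `I`, multiplied by the largest power of `p` that
does not kill it, becomes a word divisible by `p^(a-1)` and no heavier. So the distance of `I` is
attained on the words of `I` divisible by `p^(a-1)`, and these are the multiples of `p^(a-1) f_r`
(`toAmbient_mem_span_last`). This is proved by descending along the generators: if
`p^(a-1) w = d p^(j_i) f_i + …`, where the rest is divisible by `p^(j_(i+1))`, then so is
`d p^(j_i)` because `f_i` is monic, and the chain condition moves `p^(j_(i+1)) f_i` to the later
generators. The chain condition holds modulo `g` only; its lift to `R[x]` needs `p^(j_i) g` in the
ideal of the generators from the `i`-th one on, and this is true up to a factor that is a unit of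
`A` (`exists_mul_modulus_mem_tailIdeal`). In a unit expansion of `f_r` all terms but the first one
are killed by `p^(a-1)`, whence `⟨p^(a-1) f_r⟩ = ⟨p^(a-1) (x+1)^(i_0)⟩`. Finally multiplication by
`p^(a-1)` identifies words over `F` with words over `R` divisible by `p^(a-1)`, preserving weights
(`hammingWeight_pow_mul`).

*The distance over `F`.* Let `q = p^l`. A power `(x-c)^(tq)` is a polynomial in `x^q`. If
`(x-c)^(tq+1)` divides `f ≠ 0` and `deg f < pq`, split `f` according to exponents modulo `q`. Each
nonzero part is, up to a power of `x`, a polynomial in `y = x^q` of degree less than `p`, divisible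
by `(y-c^q)^t`, and so has more than `t` terms; if there is only one part, it is divisible by
`(y-c^q)^(t+1)`. So `f` has at least `t + 2` terms (`add_two_le_card_support`). A factor
`(x-c)^((p-1)p^k)` with complementary factor of degree less than `p^k` multiplies the weight by `p`,
and induction gives the general lower bound (`le_card_support_of_pow_dvd`). Powers of `x + 1` attain
it.

*Standard generating sets.* For each `k` the polynomials `f` with `p^k f` in the preimage of `I`
reduce to an ideal of `F[x]`, whose generator has a monic lift `D_k` with the same property. The
degree of `D_k` decreases with `k`, and the `p^k D_k` for those `k` where it drops form a standard
generating set (`exists_isStandardGeneratingSet`).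
-/

/-! ### Weights of polynomials over a field of characteristic `p` -/

/-- A polynomial divisible by `(x - c)^M`, `c ≠ 0`, has more than `M` terms, provided its exponents
are distinct in the field. With `v` the degree of `f`, the operator `f ↦ x f' - v f` removes
exactly the leading term and lowers the multiplicity of `c` by at most one. -/
theorem lt_card_support_of_pow_dvd {F : Type*} [Field F] {c : F} (hc : c ≠ 0) (M : ℕ) (f : F[X])
    (hf : f ≠ 0) (hinj : Set.InjOn (Nat.cast : ℕ → F) f.support) (hdvd : (X - C c) ^ M ∣ f) :
    M < f.support.card := by
  induction M generalizing f with
  | zero => exact Finset.card_pos.2 (by simpa [Finset.nonempty_iff_ne_empty] using hf)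
  | succ M ih =>
    set v := f.natDegree with hv
    have hvmem : v ∈ f.support := natDegree_mem_support_of_nonzero hf
    obtain ⟨E, hE⟩ : ∃ E : F[X], E = X * derivative f - C (v : F) * f := ⟨_, rfl⟩
    have hcoeff : ∀ n, E.coeff n = ((n : F) - v) * f.coeff n := by
      intro n
      rcases n with _ | n
      · simp [hE]
      · simp only [hE, coeff_sub, coeff_X_mul, coeff_derivative, coeff_C_mul]
        push_cast
        ring
    have hsupp : E.support = f.support.erase v := by
      ext n
      simp only [mem_support_iff, Finset.mem_erase, hcoeff, mul_ne_zero_iff, sub_ne_zero]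
      refine ⟨fun h => ⟨fun e => h.1 (by rw [e]), h.2⟩, fun h => ⟨fun e => h.1 ?_, h.2⟩⟩
      exact hinj (by simpa using h.2) hvmem e
    have hcard : E.support.card + 1 = f.support.card := by
      rw [hsupp, Finset.card_erase_add_one hvmem]
    have hE0 : E ≠ 0 := by
      intro h0
      have h1 : f.support.card ≤ 1 := by rw [← hcard, h0]; simp
      obtain ⟨n, b, hb⟩ := card_support_le_one_iff_monomial.1 h1
      have h2 : (X - C c) ∣ f := (dvd_pow_self _ (Nat.succ_ne_zero M)).trans hdvd
      rw [dvd_iff_isRoot, IsRoot, hb, eval_monomial] at h2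
      rcases mul_eq_zero.1 h2 with h3 | h3
      · exact hf (by rw [hb, h3, monomial_zero_right])
      · exact pow_ne_zero _ hc h3
    have hEd : (X - C c) ^ M ∣ E := by
      have h1 : (X - C c) ^ M ∣ derivative f := by
        have := pow_sub_one_dvd_derivative_of_pow_dvd hdvd
        rwa [Nat.add_sub_cancel] at this
      have h2 : (X - C c) ^ M ∣ f := (pow_dvd_pow _ (Nat.le_succ M)).trans hdvd
      rw [hE]
      exact dvd_sub (dvd_mul_of_dvd_right h1 X) (dvd_mul_of_dvd_right h2 _)
    have hinjE : Set.InjOn (Nat.cast : ℕ → F) E.support := by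
      rw [hsupp]
      exact hinj.mono (Finset.coe_subset.2 (Finset.erase_subset _ _))
    have := ih E hE0 hinjE hEd
    omega

/-- `contract q (x^m f)` collects the terms of `f` whose exponents are congruent to `-m`
modulo `q`. -/
theorem card_support_contract_X_pow_mul {F : Type*} [Field F] {q m : ℕ} (hq : q ≠ 0)
    (f : F[X]) :
    (contract q (X ^ m * f)).support.card = (f.support.filter fun e => q ∣ e + m).card := by
  have hco : ∀ n, (contract q (X ^ m * f)).coeff n
      = if m ≤ n * q then f.coeff (n * q - m) else 0 := fun n => by
    rw [coeff_contract hq, coeff_X_pow_mul']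
  refine Finset.card_bij (fun n _ => n * q - m) ?_ ?_ ?_
  · intro n hn
    rw [mem_support_iff, hco] at hn
    split_ifs at hn with h
    · simp only [Finset.mem_filter, mem_support_iff]
      exact ⟨hn, by rw [Nat.sub_add_cancel h]; exact dvd_mul_left _ _⟩
    · exact absurd rfl hn
  · intro n hn n' hn' e
    rw [mem_support_iff, hco] at hn hn'
    split_ifs at hn hn' with h h'
    · exact Nat.eq_of_mul_eq_mul_right (Nat.pos_of_ne_zero hq) (by omega)
    all_goals simp_all
  · intro e he
    simp only [Finset.mem_filter, mem_support_iff] at he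
    obtain ⟨h1, n, hn⟩ := he
    refine ⟨n, ?_, by rw [mul_comm, ← hn]; simp⟩
    rw [mem_support_iff, hco, mul_comm, ← hn]
    simpa using h1

theorem X_sub_C_pow_mul_char_pow {F : Type*} [Field F] {p : ℕ} [Fact p.Prime] [CharP F p]
    (c : F) (l t : ℕ) :
    (X - C c) ^ (t * p ^ l) = expand F (p ^ l) ((X - C (c ^ p ^ l)) ^ t) := by
  rw [mul_comm, pow_mul, sub_pow_char_pow, map_pow, map_sub, expand_X, expand_C, C_pow]

/-- The case `k = 0` of `le_card_support_of_pow_dvd`: split `f` according to exponents modulo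
`p^l`. Either two parts are nonzero, or the single part is a polynomial in `x^(p^l)` and has a
larger multiplicity. -/
theorem add_two_le_card_support {F : Type*} [Field F] {p : ℕ} [hp : Fact p.Prime] [CharP F p]
    {c : F} (hc : c ≠ 0) (l t : ℕ) (f : F[X]) (hf : f ≠ 0) (hdeg : f.natDegree < p ^ (l + 1))
    (hdvd : (X - C c) ^ (t * p ^ l + 1) ∣ f) : t + 2 ≤ f.support.card := by
  have hq : p ^ l ≠ 0 := pow_ne_zero _ hp.out.ne_zero
  have hq' : 0 < p ^ l := Nat.pos_of_ne_zero hq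
  have hcq : c ^ p ^ l ≠ 0 := pow_ne_zero _ hc
  obtain ⟨e, he⟩ : f.support.Nonempty := by simpa [Finset.nonempty_iff_ne_empty] using hf
  obtain ⟨m, hm, hem⟩ : ∃ m < p ^ l, p ^ l ∣ e + m := by
    refine ⟨(p ^ l - e % p ^ l) % p ^ l, Nat.mod_lt _ hq', ?_⟩
    have h1 := Nat.mod_lt e hq'
    have h2 := Nat.mod_add_div e (p ^ l)
    rcases Nat.eq_zero_or_pos (e % p ^ l) with h0 | h0
    · rw [h0, Nat.sub_zero, Nat.mod_self, add_zero]
      exact Nat.dvd_of_mod_eq_zero h0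
    · rw [Nat.mod_eq_of_lt (by omega)]
      refine ⟨e / p ^ l + 1, ?_⟩
      rw [mul_add]
      omega
  set G := contract (p ^ l) (X ^ m * f) with hG
  have hcard := card_support_contract_X_pow_mul (m := m) hq f
  rw [← hG] at hcard
  have hG0 : G ≠ 0 := by
    intro h0
    rw [h0, support_zero, Finset.card_empty, eq_comm, Finset.card_eq_zero] at hcard
    have : e ∈ (∅ : Finset ℕ) := by
      rw [← hcard]
      exact Finset.mem_filter.2 ⟨he, hem⟩
    simp at this
  have hinj : Set.InjOn (Nat.cast : ℕ → F) G.support := by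
    have key : ∀ n n', n ∈ G.support → n' ∈ G.support → n < n' → (n : F) ≠ (n' : F) := by
      intro n n' hn hn' hlt heq
      rw [mem_support_iff, hG, coeff_contract hq, coeff_X_pow_mul'] at hn hn'
      split_ifs at hn hn' with h h'
      · have h3 : n' * p ^ l - m < p ^ (l + 1) := (le_natDegree_of_ne_zero hn').trans_lt hdeg
        rw [CharP.natCast_eq_natCast F p] at heq
        have h4 : p ∣ n' - n := (Nat.modEq_iff_dvd' hlt.le).1 heq
        have h5 : n + p ≤ n' := by
          have := Nat.le_of_dvd (by omega) h4
          omega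
        have h6 := Nat.mul_le_mul_right (p ^ l) h5
        rw [add_mul] at h6
        rw [pow_succ'] at h3
        omega
      all_goals simp_all
    intro n hn n' hn' heq
    rcases lt_trichotomy n n' with h | h | h
    · exact absurd heq (key n n' hn hn' h)
    · exact h
    · exact absurd heq.symm (key n' n hn' hn h)
  -- The part `G` has more than `t` terms. Either it is all of `f`, and then its multiplicity at
  -- `c ^ p ^ l` is at least `t + 1`, or `f` has a further term.
  by_cases hall : ∀ e' ∈ f.support, p ^ l ∣ e' + m
  · have hexp : X ^ m * f = expand F (p ^ l) G := by
      ext n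
      rw [coeff_expand hq', hG]
      split_ifs with h
      · rw [coeff_contract hq, Nat.div_mul_cancel h]
      · by_contra hne
        rw [coeff_X_pow_mul'] at hne
        split_ifs at hne with h'
        · have := hall (n - m) (by simpa using hne)
          rw [Nat.sub_add_cancel h'] at this
          exact h this
        · exact hne rfl
    have h1 : t * p ^ l + 1 ≤ (expand F (p ^ l) G).rootMultiplicity c := by
      rw [le_rootMultiplicity_iff (by rwa [Ne, expand_eq_zero hq']), ← hexp]
      exact dvd_mul_of_dvd_right hdvd _
    rw [rootMultiplicity_expand_pow] at h1
    have h2 : t + 1 ≤ G.rootMultiplicity (c ^ p ^ l) := by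
      by_contra hlt
      have := Nat.mul_le_mul_left (p ^ l) (show G.rootMultiplicity (c ^ p ^ l) ≤ t by omega)
      rw [mul_comm _ t] at this
      omega
    have h3 := lt_card_support_of_pow_dvd hcq (t + 1) G hG0 hinj
      ((le_rootMultiplicity_iff hG0).1 h2)
    have h4 := hcard.trans_le (Finset.card_filter_le _ _)
    omega
  · push Not at hall
    obtain ⟨e', he', hne'⟩ := hall
    have h1 : (X - C (c ^ p ^ l)) ^ t ∣ G := by
      obtain ⟨h, rfl⟩ := (pow_dvd_pow _ (Nat.le_succ _)).trans hdvd
      rw [hG, X_sub_C_pow_mul_char_pow, mul_comm _ h, ← mul_assoc, contract_mul_expand hq]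
      exact dvd_mul_left _ _
    have h3 := lt_card_support_of_pow_dvd hcq t G hG0 hinj h1
    have h4 : (f.support.filter fun e => p ^ l ∣ e + m).card < f.support.card :=
      Finset.card_lt_card (Finset.filter_ssubset.2 ⟨e', he', hne'⟩)
    omega

/-- The terms of `h(x) G(x^q)` with `deg h < q` do not collide, so the weights multiply; only the
lower bound is stated. -/
theorem card_support_mul_le_card_support_mul_expand {F : Type*} [Field F] {q : ℕ} (hq : q ≠ 0)
    (G h : F[X]) (hh : h.natDegree < q) :
    G.support.card * h.support.card ≤ (h * expand F q G).support.card := by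
  have hco : ∀ j r, r < q → (h * expand F q G).coeff (j * q + r) = h.coeff r * G.coeff j := by
    intro j r hr
    have h1 : contract q (X ^ (q - r) * h) = C (h.coeff r) * X := by
      ext n
      rw [coeff_contract hq, coeff_X_pow_mul', coeff_C_mul, coeff_X]
      rcases n with _ | _ | n
      · simp; omega
      · simp [show q - (q - r) = r by omega]
      · have : (n + 1 + 1) * q = n * q + q + q := by ring
        rw [if_neg (show ¬ 1 = n + 1 + 1 by omega), mul_zero, coeff_eq_zero_of_natDegree_lt,
          ite_self]
        omega
    have h2 : (contract q (X ^ (q - r) * h * expand F q G)).coeff (j + 1)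
        = h.coeff r * G.coeff j := by
      rw [contract_mul_expand hq, h1, mul_assoc, coeff_C_mul, coeff_X_mul]
    rw [← h2, coeff_contract hq, mul_assoc,
      show (j + 1) * q = (j * q + r) + (q - r) by rw [add_mul]; omega, coeff_X_pow_mul]
  rw [← Finset.card_product]
  refine Finset.card_le_card_of_injOn (fun x => x.1 * q + x.2) ?_ ?_
  · rintro ⟨j, r⟩ hx
    simp only [Finset.coe_product, Set.mem_prod, Finset.mem_coe, mem_support_iff] at hx ⊢
    rw [hco _ _ ((le_natDegree_of_ne_zero hx.2).trans_lt hh)]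
    exact mul_ne_zero hx.2 hx.1
  · rintro ⟨j, r⟩ hx ⟨j', r'⟩ hx' heq
    simp only [Finset.coe_product, Set.mem_prod, Finset.mem_coe, mem_support_iff] at hx hx' heq
    have hr := (le_natDegree_of_ne_zero hx.2).trans_lt hh
    have hr' := (le_natDegree_of_ne_zero hx'.2).trans_lt hh
    have e1 : r = r' := by
      have := congrArg (· % q) heq
      simpa [Nat.add_mod, Nat.mod_eq_of_lt hr, Nat.mod_eq_of_lt hr'] using this
    subst e1
    have := Nat.eq_of_mul_eq_mul_right (Nat.pos_of_ne_zero hq) (Nat.add_right_cancel heq)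
    rw [this]

theorem card_support_X_sub_C_pow_char_sub_one {F : Type*} [Field F] {p : ℕ} [hp : Fact p.Prime]
    [CharP F p] {d : F} (hd : d ≠ 0) : p ≤ ((X - C d) ^ (p - 1)).support.card := by
  -- `(x - d)^(p-1)` is the quotient of `x^p - d^p` by `x - d`.
  have h1 : (X - C d) ^ (p - 1) = ∑ i ∈ Finset.range p, X ^ i * (C d) ^ (p - 1 - i) := by
    refine mul_right_cancel₀ (X_sub_C_ne_zero d) ?_
    rw [(Commute.all _ _).geom_sum₂_mul, ← pow_succ, Nat.sub_add_cancel hp.out.one_le,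
      sub_pow_char]
  have h2 : Finset.range p ⊆ ((X - C d) ^ (p - 1)).support := by
    intro i hi
    rw [mem_support_iff, h1, finsetSum_coeff, Finset.sum_eq_single i]
    · rw [← C_pow, coeff_mul_C, coeff_X_pow_self, one_mul]
      exact pow_ne_zero _ hd
    · intro j _ hj
      rw [← C_pow, coeff_mul_C, coeff_X_pow, if_neg hj.symm, zero_mul]
    · exact fun h => absurd hi h
  simpa using Finset.card_le_card h2

theorem pow_sub_pow_succ_add {p : ℕ} (hp : 0 < p) (k l N : ℕ) :
    p ^ (k + 1 + l + 1) - p ^ (l + 1) + N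
      = (p - 1) * p ^ (k + l + 1) + (p ^ (k + l + 1) - p ^ (l + 1) + N) := by
  have h1 : p ^ (l + 1) ≤ p ^ (k + l + 1) := Nat.pow_le_pow_right hp (by omega)
  have h2 : p ^ (k + 1 + l + 1) = (p - 1) * p ^ (k + l + 1) + p ^ (k + l + 1) := by
    rw [show k + 1 + l + 1 = (k + l + 1) + 1 by ring, pow_succ', ← Nat.succ_mul]
    congr 1
    omega
  omega

/-- The lower bound for the weight of a multiple of a power of `x - c`. In the inductive step
the factor `(x - c)^((p-1) p^(k+l+1))` is a polynomial in `x^(p^(k+l+1))` with `p` terms, and the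
complementary factor has degree less than `p^(k+l+1)`, so that no terms of the product collide. -/
theorem le_card_support_of_pow_dvd {F : Type*} [Field F] {p : ℕ} [hp : Fact p.Prime]
    [CharP F p] {c : F} (hc : c ≠ 0) (k l t : ℕ) (f : F[X]) (hf : f ≠ 0)
    (hdeg : f.natDegree < p ^ (k + l + 1))
    (hdvd : (X - C c) ^ (p ^ (k + l + 1) - p ^ (l + 1) + (t * p ^ l + 1)) ∣ f) :
    (t + 2) * p ^ k ≤ f.support.card := by
  induction k generalizing f with
  | zero =>
    rw [pow_zero, mul_one]
    refine add_two_le_card_support hc l t f hf (by simpa using hdeg) (by simpa using hdvd)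
  | succ k ih =>
    have hq : p ^ (k + l + 1) ≠ 0 := pow_ne_zero _ hp.out.ne_zero
    rw [pow_sub_pow_succ_add hp.out.pos, pow_add] at hdvd
    obtain ⟨u, hu⟩ := hdvd
    set h := (X - C c) ^ (p ^ (k + l + 1) - p ^ (l + 1) + (t * p ^ l + 1)) * u with hh
    rw [mul_assoc, ← hh] at hu
    have hh0 : h ≠ 0 := by
      rintro h0
      rw [h0, mul_zero] at hu
      exact hf hu
    have hdegh : h.natDegree < p ^ (k + l + 1) := by
      have h1 : f.natDegree = (p - 1) * p ^ (k + l + 1) + h.natDegree := by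
        rw [hu, Monic.natDegree_mul' ((monic_X_sub_C c).pow _) hh0, natDegree_pow,
          natDegree_X_sub_C, mul_one]
      have h2 : p ^ (k + 1 + l + 1) = (p - 1) * p ^ (k + l + 1) + p ^ (k + l + 1) := by
        rw [show k + 1 + l + 1 = (k + l + 1) + 1 by ring, pow_succ', ← Nat.succ_mul]
        congr 1
        have := hp.out.pos
        omega
      omega
    have h1 := ih h hh0 hdegh (dvd_mul_right _ _)
    have h2 := card_support_mul_le_card_support_mul_expand hq
      ((X - C (c ^ p ^ (k + l + 1))) ^ (p - 1)) h hdegh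
    rw [← X_sub_C_pow_mul_char_pow, mul_comm h, ← hu] at h2
    calc (t + 2) * p ^ (k + 1) = p * ((t + 2) * p ^ k) := by ring
      _ ≤ _ := Nat.mul_le_mul (card_support_X_sub_C_pow_char_sub_one (pow_ne_zero _ hc)) h1
      _ ≤ _ := h2

theorem card_support_X_sub_C_pow_mul_char_pow_le {F : Type*} [Field F] {p : ℕ} [hp : Fact p.Prime]
    [CharP F p] (c : F) (l t : ℕ) : ((X - C c) ^ (t * p ^ l)).support.card ≤ t + 1 := by
  have hq : 0 < p ^ l := pow_pos hp.out.pos _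
  rw [X_sub_C_pow_mul_char_pow]
  have : (expand F (p ^ l) ((X - C (c ^ p ^ l)) ^ t)).support
      ⊆ (Finset.range (t + 1)).image (· * p ^ l) := by
    intro n hn
    rw [mem_support_iff, coeff_expand hq] at hn
    split_ifs at hn with h
    · obtain ⟨j, rfl⟩ := h
      rw [Nat.mul_div_cancel_left _ hq] at hn
      refine Finset.mem_image.2 ⟨j, ?_, mul_comm _ _⟩
      have := le_natDegree_of_ne_zero hn
      rw [natDegree_pow, natDegree_X_sub_C, mul_one] at this
      simp; omega
    · exact absurd rfl hn
  calc _ ≤ _ := Finset.card_le_card this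
    _ ≤ _ := Finset.card_image_le
    _ = t + 1 := Finset.card_range _

theorem card_support_X_sub_C_pow_le {F : Type*} [Field F] {p : ℕ} [hp : Fact p.Prime]
    [CharP F p] (c : F) (k l t : ℕ) :
    ((X - C c) ^ (p ^ (k + l + 1) - p ^ (l + 1) + t * p ^ l)).support.card ≤ (t + 1) * p ^ k := by
  induction k with
  | zero => simpa using card_support_X_sub_C_pow_mul_char_pow_le c l t
  | succ k ih =>
    rw [pow_sub_pow_succ_add hp.out.pos, pow_add]
    calc _ ≤ _ := card_support_mul_le
      _ ≤ (p - 1 + 1) * ((t + 1) * p ^ k) :=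
        Nat.mul_le_mul (card_support_X_sub_C_pow_mul_char_pow_le c _ _) ih
      _ = (t + 1) * p ^ (k + 1) := by rw [Nat.sub_add_cancel hp.out.one_le]; ring

/-! ### Weights and distances in the code ambient, and the distance over a field -/

section Code

variable {R : Type} [CommRing R] {c : ℤ} {n : ℕ}

theorem modByMonicHom_toAmbient [Nontrivial R] (hn : n ≠ 0) {f : R[X]} (hf : f.natDegree < n) :
    AdjoinRoot.modByMonicHom (codeModulus_monic R c hn) (toAmbient c n f) = f := by
  rw [AdjoinRoot.modByMonicHom_mk, modByMonic_eq_self_iff (codeModulus_monic R c hn),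
    codeModulus, degree_X_pow_sub_C (Nat.pos_of_ne_zero hn)]
  exact degree_le_natDegree.trans_lt (by exact_mod_cast hf)

theorem hammingWeight_toAmbient [Nontrivial R] (hn : n ≠ 0) {f : R[X]} (hf : f.natDegree < n) :
    hammingWeight hn (toAmbient c n f) = f.support.card := by
  rw [hammingWeight, modByMonicHom_toAmbient hn hf]

theorem toAmbient_eq_zero_iff [Nontrivial R] (hn : n ≠ 0) {f : R[X]} (hf : f.natDegree < n) :
    toAmbient c n f = 0 ↔ f = 0 := by
  refine ⟨fun h => ?_, fun h => by rw [h, toAmbient, map_zero]⟩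
  rw [← modByMonicHom_toAmbient (c := c) hn hf, h, map_zero]

theorem exists_toAmbient_eq [Nontrivial R] (hn : n ≠ 0) (w : CodeAmbient R c n) :
    ∃ f : R[X], f.natDegree < n ∧ toAmbient c n f = w := by
  obtain ⟨f, rfl⟩ := AdjoinRoot.mk_surjective w
  refine ⟨f %ₘ codeModulus R c n, ?_, ?_⟩
  · have h1 := natDegree_modByMonic_lt f (codeModulus_monic R c hn) (fun h => by
      have := congrArg natDegree h
      rw [codeModulus, natDegree_X_pow_sub_C, natDegree_one] at this
      exact hn this)
    rwa [codeModulus, natDegree_X_pow_sub_C] at h1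
  · rw [toAmbient, AdjoinRoot.mk_eq_mk, modByMonic_eq_sub_mul_div, sub_sub_cancel_left, dvd_neg]
    exact dvd_mul_right _ _

theorem toAmbient_mul (x y : R[X]) :
    toAmbient c n (x * y) = toAmbient c n x * toAmbient c n y :=
  map_mul _ _ _

theorem toAmbient_pow (x : R[X]) (k : ℕ) : toAmbient c n (x ^ k) = toAmbient c n x ^ k :=
  map_pow _ _ _

theorem hammingWeight_eq_zero_iff (hn : n ≠ 0) {w : CodeAmbient R c n} :
    hammingWeight hn w = 0 ↔ w = 0 := by
  rw [hammingWeight, Finset.card_eq_zero, support_eq_empty]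
  refine ⟨fun h => ?_, fun h => by rw [h, map_zero]⟩
  rw [← AdjoinRoot.mk_leftInverse (codeModulus_monic R c hn) w, h, map_zero]

theorem codeModulus_natDegree [Nontrivial R] (c : ℤ) {n : ℕ} : (codeModulus R c n).natDegree = n :=
  natDegree_X_pow_sub_C

theorem natCast_pow_eq_C (p k : ℕ) : (p : R[X]) ^ k = C ((p : R) ^ k) := by
  rw [C_pow, ← C_eq_natCast]

theorem coeff_natCast_pow_mul (p k : ℕ) (f : R[X]) (i : ℕ) :
    ((p : R[X]) ^ k * f).coeff i = (p : R) ^ k * f.coeff i := by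
  rw [natCast_pow_eq_C, coeff_C_mul]

theorem hammingWeight_natCast_pow_mul_le (hn : n ≠ 0) (p k : ℕ) (y : R[X]) :
    hammingWeight hn (toAmbient c n ((p : R[X]) ^ k * y))
      ≤ hammingWeight hn (toAmbient c n y) := by
  rw [hammingWeight, hammingWeight, AdjoinRoot.modByMonicHom_mk, AdjoinRoot.modByMonicHom_mk,
    natCast_pow_eq_C, ← smul_eq_C_mul, smul_modByMonic]
  exact Finset.card_le_card (support_smul _ _)

theorem exists_eq_add_of_toAmbient_mem_span {ι : Type} (G : ι → R[X]) (S : Set ι)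
    {x : R[X]} (hx : toAmbient c n x ∈ Ideal.span ((fun k => toAmbient c n (G k)) '' S)) :
    ∃ y ∈ Ideal.span (G '' S), ∃ b, x = y + b * codeModulus R c n := by
  rw [show (fun k => toAmbient c n (G k)) '' S = (AdjoinRoot.mk (codeModulus R c n)) '' (G '' S) by
    rw [Set.image_image], ← Ideal.map_span,
    Ideal.mem_map_iff_of_surjective _ AdjoinRoot.mk_surjective] at hx
  obtain ⟨y, hy, hyx⟩ := hx
  rw [eq_comm, AdjoinRoot.mk_eq_mk] at hyx
  obtain ⟨b, hb⟩ := hyx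
  exact ⟨y, hy, b, by rw [mul_comm, ← hb]; ring⟩

theorem natCast_pow_mul_mem_of_le {p : ℕ} {J : Ideal R[X]} {l k : ℕ} (hlk : l ≤ k) {f : R[X]}
    (hf : (p : R[X]) ^ l * f ∈ J) : (p : R[X]) ^ k * f ∈ J := by
  obtain ⟨e, rfl⟩ := Nat.exists_eq_add_of_le' hlk
  rw [pow_add, mul_assoc]
  exact J.mul_mem_left _ hf

theorem codeDistance_le (hn : n ≠ 0) {I : Ideal (CodeAmbient R c n)} {w : CodeAmbient R c n}
    (hw : w ∈ I) (hw0 : w ≠ 0) : codeDistance hn I ≤ hammingWeight hn w :=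
  Nat.sInf_le ⟨w, hw, hw0, rfl⟩

theorem codeDistance_eq (hn : n ≠ 0) {I : Ideal (CodeAmbient R c n)} {d : ℕ}
    (h₁ : ∃ w ∈ I, w ≠ 0 ∧ hammingWeight hn w ≤ d)
    (h₂ : ∀ w ∈ I, w ≠ 0 → d ≤ hammingWeight hn w) : codeDistance hn I = d := by
  obtain ⟨w, hw, hw0, hwd⟩ := h₁
  refine le_antisymm ((codeDistance_le hn hw hw0).trans hwd) (le_csInf ⟨_, w, hw, hw0, rfl⟩ ?_)
  rintro _ ⟨v, hv, hv0, rfl⟩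
  exact h₂ v hv hv0

/-- Two codes, possibly over different alphabets, have the same distance as soon as each nonzero
word of either one is at least as heavy as some nonzero word of the other one. -/
theorem codeDistance_congr {R' : Type} [CommRing R'] {c' : ℤ} {n' : ℕ} (hn : n ≠ 0) (hn' : n' ≠ 0)
    {I : Ideal (CodeAmbient R c n)} {J : Ideal (CodeAmbient R' c' n')}
    (h₁ : ∀ w ∈ I, w ≠ 0 → ∃ v ∈ J, v ≠ 0 ∧ hammingWeight hn' v ≤ hammingWeight hn w)
    (h₂ : ∀ v ∈ J, v ≠ 0 → ∃ w ∈ I, w ≠ 0 ∧ hammingWeight hn w ≤ hammingWeight hn' v) :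
    codeDistance hn I = codeDistance hn' J := by
  by_cases hI : ∃ w ∈ I, w ≠ 0
  · have hne : {d | ∃ w ∈ I, w ≠ 0 ∧ hammingWeight hn w = d}.Nonempty := by
      obtain ⟨w, hw, hw0⟩ := hI
      exact ⟨_, w, hw, hw0, rfl⟩
    obtain ⟨w, hw, hw0, hwd⟩ := Nat.sInf_mem hne
    symm
    refine codeDistance_eq hn' ?_ ?_
    · obtain ⟨v, hv, hv0, hvw⟩ := h₁ w hw hw0
      exact ⟨v, hv, hv0, hvw.trans_eq hwd⟩
    · intro v hv hv0
      obtain ⟨u, hu, hu0, huv⟩ := h₂ v hv hv0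
      exact (codeDistance_le hn hu hu0).trans huv
  · have h3 : {d | ∃ w ∈ I, w ≠ 0 ∧ hammingWeight hn w = d} = ∅ := by
      rw [Set.eq_empty_iff_forall_notMem]
      rintro _ ⟨w, hw, hw0, -⟩
      exact hI ⟨w, hw, hw0⟩
    have h4 : {d | ∃ w ∈ J, w ≠ 0 ∧ hammingWeight hn' w = d} = ∅ := by
      rw [Set.eq_empty_iff_forall_notMem]
      rintro _ ⟨v, hv, hv0, -⟩
      obtain ⟨w, hw, hw0, -⟩ := h₂ v hv hv0
      exact hI ⟨w, hw, hw0⟩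
    rw [codeDistance, codeDistance, h3, h4]

end Code

theorem map_codeModulus {R F : Type} [CommRing R] [CommRing F] (π : R →+* F) (c : ℤ) (n : ℕ) :
    (codeModulus R c n).map π = codeModulus F c n := by
  simp [codeModulus]

/-- The intervals in Dinh's formula cover `1 ≤ i < p^s`. The case `k = 0` is the range of
exponents up to `(p-1) p^(s-1)`; the length is written as `s = k + l + 1`. -/
theorem exists_dinh_range {p : ℕ} (hp : 2 ≤ p) (s i : ℕ) (hi : 1 ≤ i) (his : i < p ^ s) :
    ∃ k l t, s = k + l + 1 ∧ t + 2 ≤ p ∧ p ^ s - p ^ (l + 1) + (t * p ^ l + 1) ≤ i ∧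
      i ≤ p ^ s - p ^ (l + 1) + (t + 1) * p ^ l := by
  induction s generalizing i with
  | zero => simp at his; omega
  | succ s ih =>
    have hps : 0 < p ^ s := pow_pos (by omega) _
    have hsplit : p ^ (s + 1) = (p - 1) * p ^ s + p ^ s := by
      rw [pow_succ', ← Nat.succ_mul]
      congr 1
      omega
    by_cases h : i ≤ (p - 1) * p ^ s
    · have h1 := Nat.div_add_mod (i - 1) (p ^ s)
      have h2 := Nat.mod_lt (i - 1) hps
      have h3 : (i - 1) / p ^ s < p - 1 := by
        rw [Nat.div_lt_iff_lt_mul hps]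
        omega
      have h4 := Nat.div_mul_le_self (i - 1) (p ^ s)
      rw [mul_comm] at h1
      refine ⟨0, s, (i - 1) / p ^ s, by omega, by omega, ?_, ?_⟩
      · rw [Nat.sub_self]; omega
      · rw [Nat.sub_self, add_mul, one_mul]; omega
    · obtain ⟨k, l, t, hs, ht, h1, h2⟩ := ih (i - (p - 1) * p ^ s) (by omega) (by omega)
      have h3 : p ^ (l + 1) ≤ p ^ s := Nat.pow_le_pow_right (by omega) (by omega)
      exact ⟨k + 1, l, t, by omega, ht, by omega, by omega⟩

theorem dvd_of_toAmbient_mem_span {F : Type} [CommRing F] {c : ℤ} {n : ℕ} {u f : F[X]}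
    (hu : u ∣ codeModulus F c n) (hf : toAmbient c n f ∈ Ideal.span {toAmbient c n u}) :
    u ∣ f := by
  obtain ⟨v, hv⟩ := Ideal.mem_span_singleton.1 hf
  obtain ⟨v, rfl⟩ := AdjoinRoot.mk_surjective v
  rw [toAmbient, toAmbient, ← map_mul, AdjoinRoot.mk_eq_mk] at hv
  have := (hu.trans hv).add (dvd_mul_right u v)
  rwa [sub_add_cancel] at this

/-- Dinh's theorem on the codes `⟨(x+1)^i⟩` over a field of characteristic `p`. -/
theorem dinhDistance_codeDistance {F : Type} [Field F] {p s : ℕ} [hp : Fact p.Prime] [CharP F p]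
    (hn : p ^ s ≠ 0) (c : ℤ) (hg : codeModulus F c (p ^ s) = (X + 1) ^ p ^ s) {i : ℕ}
    (hi : i < p ^ s) :
    DinhDistance p s i
      (codeDistance hn (Ideal.span {toAmbient c (p ^ s) ((X + 1 : F[X]) ^ i)})) := by
  have hX : (X + 1 : F[X]) = X - C (-1) := by simp
  have hdegX : ∀ N, ((X + 1 : F[X]) ^ N).natDegree = N := fun N => by
    rw [hX, natDegree_pow, natDegree_X_sub_C, mul_one]
  have hneX : ∀ N, (X + 1 : F[X]) ^ N ≠ 0 := fun N => by
    rw [hX]; exact pow_ne_zero _ (X_sub_C_ne_zero _)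
  -- A word of the code is given by a nonzero multiple of `(x + 1) ^ i` of degree less than `p ^ s`.
  have hword : ∀ d : ℕ, (∃ N, i ≤ N ∧ N < p ^ s ∧ ((X + 1 : F[X]) ^ N).support.card ≤ d) →
      (∀ f : F[X], f ≠ 0 → f.natDegree < p ^ s → (X + 1) ^ i ∣ f → d ≤ f.support.card) →
      codeDistance hn (Ideal.span {toAmbient c (p ^ s) ((X + 1 : F[X]) ^ i)}) = d := by
    rintro d ⟨N, hiN, hN, hd⟩ hlow
    refine codeDistance_eq hn ⟨toAmbient c (p ^ s) ((X + 1) ^ N), ?_, ?_, ?_⟩ ?_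
    · rw [Ideal.mem_span_singleton]
      exact map_dvd _ (pow_dvd_pow _ hiN)
    · rw [Ne, toAmbient_eq_zero_iff hn (by rwa [hdegX])]
      exact hneX N
    · rwa [hammingWeight_toAmbient hn (by rwa [hdegX])]
    · intro w hw hw0
      obtain ⟨f, hf, rfl⟩ := exists_toAmbient_eq hn w
      rw [hammingWeight_toAmbient hn hf]
      rw [Ne, toAmbient_eq_zero_iff hn hf] at hw0
      refine hlow f hw0 hf (dvd_of_toAmbient_mem_span ?_ hw)
      rw [hg]
      exact pow_dvd_pow _ hi.le
  rcases Nat.eq_zero_or_pos i with rfl | hi0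
  · rw [hword 1 ⟨0, le_rfl, hi, ?_⟩ ?_]
    · exact DinhDistance.zero
    · rw [pow_zero, ← C_1, ← monomial_zero_left]
      exact card_support_le_one_iff_monomial.2 ⟨0, 1, rfl⟩
    · intro f hf _ _
      exact Finset.card_pos.2 (by simpa [Finset.nonempty_iff_ne_empty] using hf)
  · obtain ⟨k, l, t, rfl, ht, h1, h2⟩ := exists_dinh_range hp.out.two_le s i hi0 hi
    have hd : codeDistance hn
        (Ideal.span {toAmbient c (p ^ (k + l + 1)) ((X + 1 : F[X]) ^ i)}) = (t + 2) * p ^ k := by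
      refine hword _ ⟨_, h2, ?_, ?_⟩ ?_
      · have h3 : p ^ (l + 1) ≤ p ^ (k + l + 1) := Nat.pow_le_pow_right hp.out.pos (by omega)
        have h4 : (t + 1) * p ^ l < p ^ (l + 1) := by
          rw [pow_succ']
          exact Nat.mul_lt_mul_of_pos_right (by omega) (pow_pos hp.out.pos _)
        omega
      · rw [hX]
        exact card_support_X_sub_C_pow_le (-1) k l (t + 1)
      · intro f hf hdeg hdvd
        refine le_card_support_of_pow_dvd (c := -1) (by simp) k l t f hf hdeg ?_
        rw [← hX]
        exact (pow_dvd_pow _ h1).trans hdvd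
    rw [hd]
    rcases Nat.eq_zero_or_pos k with rfl | hk
    · rw [pow_zero, mul_one]
      refine DinhDistance.low _ t (by omega) ?_ ?_
      · simpa using h1
      · simpa using h2
    · refine DinhDistance.high i (t + 1) k (by omega) (by omega) hk (by omega) ?_ ?_
      · rw [show k + l + 1 - k = l + 1 by omega]
        simpa [add_assoc] using h1
      · rw [show k + l + 1 - k = l + 1 by omega]
        simpa using h2

/-! ### Chain rings with maximal ideal `(p)` -/

/-- The reduction `π : R → F` of a chain ring `R` with maximal ideal `(p)` and nilpotency index
`a` onto its residue field `F`. -/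
structure IsChainReduction {R F : Type} [CommRing R] [Field F] (p a : ℕ) (π : R →+* F) : Prop where
  pos : 0 < a
  surjective : Function.Surjective π
  eq_zero_iff : ∀ x, π x = 0 ↔ (p : R) ∣ x
  pow_eq_zero : (p : R) ^ a = 0
  eq_zero_of_pow_mul : ∀ x, (p : R) ^ (a - 1) * x = 0 → π x = 0

namespace IsChainReduction

variable {R F : Type} [CommRing R] [Field F] {p a : ℕ} {π : R →+* F}

theorem map_p (H : IsChainReduction p a π) : π (p : R) = 0 := (H.eq_zero_iff _).2 dvd_rfl

theorem natCast_eq_zero (H : IsChainReduction p a π) : (p : F) = 0 := by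
  rw [← map_natCast π, H.map_p]

theorem polynomial_pow_eq_zero (H : IsChainReduction p a π) : (p : R[X]) ^ a = 0 := by
  rw [natCast_pow_eq_C, H.pow_eq_zero, C_0]

theorem polynomial_pow_eq_zero_of_le (H : IsChainReduction p a π) {k : ℕ} (hk : a ≤ k) :
    (p : R[X]) ^ k = 0 :=
  pow_eq_zero_of_le hk H.polynomial_pow_eq_zero

theorem nontrivial (_ : IsChainReduction p a π) : Nontrivial R := π.domain_nontrivial

theorem map_polynomial_p (H : IsChainReduction p a π) : (p : R[X]).map π = 0 := by
  rw [Polynomial.map_natCast, ← C_eq_natCast, H.natCast_eq_zero, C_0]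

theorem map_eq_zero_iff (H : IsChainReduction p a π) (f : R[X]) :
    f.map π = 0 ↔ (p : R[X]) ∣ f := by
  rw [← C_eq_natCast, C_dvd_iff_dvd_coeff]
  simp only [← H.eq_zero_iff, Polynomial.ext_iff, coeff_map, coeff_zero]

theorem map_eq_zero_of_pow_mul (H : IsChainReduction p a π) {k : ℕ} (hk : k < a) {f : R[X]}
    (hf : (p : R[X]) ^ k * f = 0) : f.map π = 0 := by
  ext i
  rw [coeff_map, coeff_zero]
  refine H.eq_zero_of_pow_mul _ ?_
  have h1 := congrArg (fun g => g.coeff i) hf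
  simp only [coeff_natCast_pow_mul, coeff_zero] at h1
  rw [show a - 1 = (a - 1 - k) + k by omega, pow_add, mul_assoc, h1, mul_zero]

theorem isUnit_of_map_ne_zero (H : IsChainReduction p a π) {x : R} (hx : π x ≠ 0) : IsUnit x := by
  obtain ⟨y, hy⟩ := H.surjective (π x)⁻¹
  have h1 : π (x * y - 1) = 0 := by
    rw [map_sub, map_mul, hy, mul_inv_cancel₀ hx, map_one, sub_self]
  obtain ⟨z, hz⟩ := (H.eq_zero_iff _).1 h1
  have hnil : IsNilpotent ((p : R) * z) := ⟨a, by rw [mul_pow, H.pow_eq_zero, zero_mul]⟩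
  have h2 : IsUnit (x * y) := by
    rw [show x * y = 1 + p * z by rw [← hz]; ring]
    exact hnil.isUnit_one_add
  exact isUnit_of_mul_isUnit_left h2

theorem map_surjective (H : IsChainReduction p a π) (f : F[X]) : ∃ g : R[X], g.map π = f :=
  Polynomial.map_surjective π H.surjective f

theorem isNilpotent_toAmbient_p (H : IsChainReduction p a π) (c : ℤ) (n : ℕ) :
    IsNilpotent (toAmbient c n (p : R[X])) :=
  ⟨a, by rw [toAmbient, ← map_pow, H.polynomial_pow_eq_zero, map_zero]⟩

theorem isNilpotent_X_add_one (H : IsChainReduction p a π) {c : ℤ} {n : ℕ}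
    (hg : codeModulus F c n = (X + 1) ^ n) : IsNilpotent (toAmbient c n (X + 1 : R[X])) := by
  have h1 : ((X + 1) ^ n - codeModulus R c n).map π = 0 := by
    rw [Polynomial.map_sub, map_codeModulus, hg]
    simp
  obtain ⟨t, ht⟩ := (H.map_eq_zero_iff _).1 h1
  have h2 : toAmbient c n (X + 1 : R[X]) ^ n = toAmbient c n (p : R[X]) * toAmbient c n t := by
    rw [← map_mul, ← ht, map_sub, AdjoinRoot.mk_self, sub_zero, map_pow]
  obtain ⟨k, hk⟩ := H.isNilpotent_toAmbient_p c n
  exact ⟨n * k, by rw [pow_mul, h2, mul_pow, hk, zero_mul]⟩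

/-- A polynomial which does not vanish at `-1` modulo `p` is a unit in the code ambient, because
there both `p` and `x + 1` are nilpotent. -/
theorem isUnit_toAmbient (H : IsChainReduction p a π) {c : ℤ} {n : ℕ}
    (hg : codeModulus F c n = (X + 1) ^ n) {v : R[X]} (hv : (v.map π).eval (-1) ≠ 0) :
    IsUnit (toAmbient c n v) := by
  have h1 : X - C (-1) ∣ v - C (v.eval (-1)) := by
    rw [dvd_iff_isRoot]
    simp
  obtain ⟨q, hq⟩ := h1
  have h2 : v = C (v.eval (-1)) + (X + 1) * q := by
    rw [← sub_eq_iff_eq_add', hq]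
    simp
  have h3 : IsUnit (v.eval (-1)) := by
    refine H.isUnit_of_map_ne_zero ?_
    rw [eval_map] at hv
    rwa [← eval₂_at_apply, map_neg, map_one]
  rw [h2, toAmbient, map_add, map_mul]
  refine IsNilpotent.isUnit_add_left_of_commute ?_ ?_ (Commute.all _ _)
  · exact (Commute.all _ _).isNilpotent_mul_right (H.isNilpotent_X_add_one hg)
  · exact (h3.map C).map _

/-- Divisibility by a power of `p` can be cancelled against a monic factor. -/
theorem pow_dvd_of_monic (H : IsChainReduction p a π) {f b d : R[X]} (hf : f.Monic) {k : ℕ}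
    (h : b * f = (p : R[X]) ^ k * d) : (p : R[X]) ^ k ∣ b := by
  have h1 := div_modByMonic_unique (f := 0) (g := f)
    ((p : R[X]) ^ k * (d /ₘ f) - b) ((p : R[X]) ^ k * (d %ₘ f)) hf ⟨?_, ?_⟩
  · rw [zero_divByMonic] at h1
    exact ⟨d /ₘ f, (sub_eq_zero.1 h1.1.symm).symm⟩
  · have h2 := modByMonic_add_div d f
    calc _ = (p : R[X]) ^ k * (d %ₘ f + f * (d /ₘ f)) - b * f := by ring
      _ = 0 := by rw [h2, h, sub_self]
  · have := H.nontrivial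
    refine lt_of_le_of_lt ?_ (degree_modByMonic_lt d hf)
    rw [natCast_pow_eq_C, ← smul_eq_C_mul]
    exact degree_smul_le _ _

end IsChainReduction

/-! ### The words divisible by `p^(a-1)` -/

section TailIdeal

variable {R : Type} [CommRing R] {p : ℕ}

/-- The ideal of `R[x]` spanned by the generators `p^(j k) f k` with `i ≤ k`. -/
noncomputable def tailIdeal (p : ℕ) {r : ℕ} (j : Fin (r + 1) → ℕ) (f : Fin (r + 1) → R[X])
    (i : Fin (r + 1)) :
    Ideal R[X] :=
  Ideal.span ((fun k => (p : R[X]) ^ j k * f k) '' Set.Ici i)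

theorem mem_tailIdeal_castSucc {r : ℕ} {j : Fin (r + 1) → ℕ} {f : Fin (r + 1) → R[X]} {i : Fin r}
    {x : R[X]} : x ∈ tailIdeal p j f i.castSucc ↔
      ∃ b, ∃ z ∈ tailIdeal p j f i.succ, x = b * ((p : R[X]) ^ j i.castSucc * f i.castSucc) + z := by
  have : Set.Ici i.castSucc = insert i.castSucc (Set.Ici i.succ) := by
    ext k
    simp only [Set.mem_Ici, Set.mem_insert_iff, Fin.le_def, Fin.ext_iff, Fin.val_castSucc,
      Fin.val_succ]
    omega
  rw [tailIdeal, this, Set.image_insert_eq, Ideal.mem_span_insert]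
  rfl

theorem pow_dvd_of_mem_tailIdeal {r : ℕ} {j : Fin (r + 1) → ℕ} (hj : StrictMono j)
    {f : Fin (r + 1) → R[X]} {i : Fin (r + 1)} {x : R[X]} (hx : x ∈ tailIdeal p j f i) :
    (p : R[X]) ^ j i ∣ x := by
  rw [← Ideal.mem_span_singleton]
  refine Ideal.span_le.2 ?_ hx
  rintro _ ⟨k, hk, rfl⟩
  rw [SetLike.mem_coe, Ideal.mem_span_singleton]
  exact dvd_mul_of_dvd_left (pow_dvd_pow _ (hj.monotone hk)) _

end TailIdeal

namespace IsChainReduction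

variable {R F : Type} [CommRing R] [Field F] {p a : ℕ} {π : R →+* F}

section Torsion

variable {c : ℤ} {n : ℕ} {I : Ideal (CodeAmbient R c n)} {r : ℕ} {j : Fin (r + 1) → ℕ}
  {f : Fin (r + 1) → R[X]}

/-- The chain condition, lifted from the code ambient to `R[x]`. -/
theorem exists_chain (H : IsChainReduction p a π) (hn : n ≠ 0)
    (hI : IsStandardGeneratingSet p a I r j f) (i : Fin r) :
    ∃ y ∈ tailIdeal p j f i.succ, ∃ b, (p : R[X]) ^ j i.succ * f i.castSucc
      = y + b * ((p : R[X]) ^ j i.succ * codeModulus R c n) := by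
  obtain ⟨y, hy, b, hb⟩ := exists_eq_add_of_toAmbient_mem_span _ _ (hI.chain i)
  obtain ⟨y', hy'⟩ := pow_dvd_of_mem_tailIdeal hI.j_strictMono hy
  obtain ⟨b', rfl⟩ := H.pow_dvd_of_monic (codeModulus_monic R c hn) (b := b) (k := j i.succ)
    (d := f i.castSucc - y') (by rw [mul_sub, hb, hy']; ring)
  exact ⟨y, hy, b', by rw [hb]; ring⟩

/-- The generators with index at least `i` generate `p^(j i) g` up to a factor which is a unit in
the code ambient. The factor is needed because the chain condition is imposed modulo `g` only. -/
theorem exists_mul_modulus_mem_tailIdeal (H : IsChainReduction p a π) (hn : n ≠ 0)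
    (hg : codeModulus F c n = (X + 1) ^ n) (hI : IsStandardGeneratingSet p a I r j f)
    (i : Fin (r + 1)) :
    ∃ v : R[X], (v.map π).eval (-1) ≠ 0 ∧
      v * ((p : R[X]) ^ j i * codeModulus R c n) ∈ tailIdeal p j f i := by
  induction i using Fin.induction with
  | zero =>
    refine ⟨1, by simp, ?_⟩
    rw [one_mul, tailIdeal, show Set.Ici (0 : Fin (r + 1)) = Set.univ from Set.Ici_bot,
      Set.image_univ]
    exact hI.modulus_mem
  | succ i ih =>
    obtain ⟨v, hv, hmem⟩ := ih
    obtain ⟨d, z, hz, hvz⟩ := mem_tailIdeal_castSucc.1 hmem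
    obtain ⟨z', hz'⟩ := pow_dvd_of_mem_tailIdeal hI.j_strictMono hz
    obtain ⟨y, hy, b, hb⟩ := H.exists_chain hn hI i
    have hlt : j i.castSucc < j i.succ := hI.j_strictMono (Fin.castSucc_lt_succ)
    obtain ⟨e, he, hej⟩ : ∃ e, 0 < e ∧ j i.succ = j i.castSucc + e :=
      ⟨j i.succ - j i.castSucc, by omega, by omega⟩
    have ha : j i.castSucc < a := by
      have := hI.j_le i.castSucc
      have := H.pos
      omega
    -- Modulo `p` the factor `d` vanishes at `-1`, as `f i` has degree less than `n`.
    have hd : (d.map π).eval (-1) = 0 := by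
      by_contra hd
      have h1 : (p : R[X]) ^ j i.castSucc
          * (v * codeModulus R c n - d * f i.castSucc - (p : R[X]) ^ e * z') = 0 := by
        have : v * ((p : R[X]) ^ j i.castSucc * codeModulus R c n)
          - d * ((p : R[X]) ^ j i.castSucc * f i.castSucc) - (p : R[X]) ^ j i.succ * z' = 0 := by
          rw [hvz, hz']; ring
        rw [hej, pow_add] at this
        rw [← this]; ring
      have h2 := H.map_eq_zero_of_pow_mul ha h1
      rw [Polynomial.map_sub, Polynomial.map_sub, Polynomial.map_mul, Polynomial.map_mul,
        Polynomial.map_mul, Polynomial.map_pow, H.map_polynomial_p, zero_pow he.ne', zero_mul,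
        sub_zero, map_codeModulus, hg, sub_eq_zero] at h2
      have h3 : IsCoprime ((X + 1 : F[X]) ^ n) (d.map π) := by
        refine IsCoprime.pow_left ?_
        rw [show (X + 1 : F[X]) = X - C (-1) by simp]
        exact (irreducible_X_sub_C _).coprime_iff_not_dvd.2 (by rwa [dvd_iff_isRoot])
      have h4 := h3.dvd_of_dvd_mul_left (h2 ▸ dvd_mul_left _ _)
      have h5 := natDegree_le_of_dvd h4 ((hI.monic i.castSucc).map π).ne_zero
      rw [show (X + 1 : F[X]) = X - C (-1) by simp, natDegree_pow, natDegree_X_sub_C, mul_one,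
        (hI.monic i.castSucc).natDegree_map] at h5
      exact absurd (hI.natDegree_lt i.castSucc) (by omega)
    refine ⟨v - d * b, by simpa [hd] using hv, ?_⟩
    have h6 : (v - d * b) * ((p : R[X]) ^ j i.succ * codeModulus R c n)
        = d * y + (p : R[X]) ^ e * z := by
      have h7 : (p : R[X]) ^ e * (v * ((p : R[X]) ^ j i.castSucc * codeModulus R c n))
          = (p : R[X]) ^ e * (d * ((p : R[X]) ^ j i.castSucc * f i.castSucc) + z) := by rw [hvz]
      have h8 : d * ((p : R[X]) ^ j i.succ * f i.castSucc)
          = d * (y + b * ((p : R[X]) ^ j i.succ * codeModulus R c n)) := by rw [hb]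
      rw [hej, pow_add] at h8 ⊢
      linear_combination h7 + h8
    rw [h6]
    exact add_mem (Ideal.mul_mem_left _ _ hy) (Ideal.mul_mem_left _ _ hz)

/-- The words of `I` which are divisible by `p^(a-1)` are the multiples of `p^(a-1) f_r`. -/
theorem toAmbient_mem_span_last (H : IsChainReduction p a π) (hn : n ≠ 0)
    (hg : codeModulus F c n = (X + 1) ^ n) (hI : IsStandardGeneratingSet p a I r j f) {w : R[X]}
    (hw : toAmbient c n ((p : R[X]) ^ (a - 1) * w) ∈ I) :
    toAmbient c n ((p : R[X]) ^ (a - 1) * w) ∈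
      Ideal.span {toAmbient c n ((p : R[X]) ^ (a - 1) * f (Fin.last r))} := by
  have key : ∀ i : Fin (r + 1), ∃ v : R[X], (v.map π).eval (-1) ≠ 0 ∧
      v * ((p : R[X]) ^ (a - 1) * w) ∈ tailIdeal p j f i := by
    intro i
    induction i using Fin.induction with
    | zero =>
      have huniv : Set.Ici (0 : Fin (r + 1)) = Set.univ := Set.Ici_bot
      rw [hI.span_eq, ← Set.image_univ, ← huniv] at hw
      obtain ⟨y, hy, b, hb⟩ := exists_eq_add_of_toAmbient_mem_span _ _ hw
      change y ∈ tailIdeal p j f 0 at hy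
      obtain ⟨y', hy'⟩ := pow_dvd_of_mem_tailIdeal hI.j_strictMono hy
      obtain ⟨e, he⟩ : ∃ e, a - 1 = j 0 + e := ⟨a - 1 - j 0, by have := hI.j_le 0; omega⟩
      obtain ⟨b', rfl⟩ := H.pow_dvd_of_monic (codeModulus_monic R c hn) (b := b) (k := j 0)
        (d := (p : R[X]) ^ e * w - y') (by
          rw [he, pow_add] at hb
          linear_combination -hb - hy')
      obtain ⟨v, hv, hmem⟩ := H.exists_mul_modulus_mem_tailIdeal hn hg hI 0
      refine ⟨v, hv, ?_⟩
      rw [hb, show v * (y + (p : R[X]) ^ j 0 * b' * codeModulus R c n)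
        = v * y + b' * (v * ((p : R[X]) ^ j 0 * codeModulus R c n)) by ring]
      exact add_mem (Ideal.mul_mem_left _ _ hy) (Ideal.mul_mem_left _ _ hmem)
    | succ i ih =>
      obtain ⟨v, hv, hmem⟩ := ih
      obtain ⟨d, z, hz, hvz⟩ := mem_tailIdeal_castSucc.1 hmem
      obtain ⟨z', hz'⟩ := pow_dvd_of_mem_tailIdeal hI.j_strictMono hz
      obtain ⟨e, he⟩ : ∃ e, a - 1 = j i.succ + e :=
        ⟨a - 1 - j i.succ, by have := hI.j_le i.succ; omega⟩
      obtain ⟨d', hd'⟩ := H.pow_dvd_of_monic (hI.monic i.castSucc) (k := j i.succ)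
        (b := d * (p : R[X]) ^ j i.castSucc) (d := v * (p : R[X]) ^ e * w - z') (by
          rw [he, pow_add] at hvz
          linear_combination -hvz - hz')
      obtain ⟨y, hy, b, hb⟩ := H.exists_chain hn hI i
      obtain ⟨u, hu, humem⟩ := H.exists_mul_modulus_mem_tailIdeal hn hg hI i.succ
      refine ⟨u * v, by simpa using ⟨hu, hv⟩, ?_⟩
      have h1 : u * v * ((p : R[X]) ^ (a - 1) * w) = u * d' * y
          + d' * b * (u * ((p : R[X]) ^ j i.succ * codeModulus R c n)) + u * z := by
        linear_combination u * hvz + u * f i.castSucc * hd' + u * d' * hb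
      rw [h1]
      exact add_mem (add_mem (Ideal.mul_mem_left _ _ hy) (Ideal.mul_mem_left _ _ humem))
        (Ideal.mul_mem_left _ _ hz)
  obtain ⟨v, hv, hmem⟩ := key (Fin.last r)
  have hlast : Set.Ici (Fin.last r) = {Fin.last r} := Set.Ici_top
  rw [tailIdeal, hlast, Set.image_singleton, Ideal.mem_span_singleton] at hmem
  obtain ⟨d, hd⟩ := hmem
  obtain ⟨d', hd'⟩ := H.pow_dvd_of_monic (hI.monic (Fin.last r)) (k := a - 1)
    (b := (p : R[X]) ^ j (Fin.last r) * d) (d := v * w) (by linear_combination -hd)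
  have h1 : v * ((p : R[X]) ^ (a - 1) * w)
      = (p : R[X]) ^ (a - 1) * f (Fin.last r) * d' := by
    linear_combination hd + f (Fin.last r) * hd'
  rw [Ideal.mem_span_singleton, ← (H.isUnit_toAmbient hg hv).dvd_mul_left, ← map_mul, h1, map_mul]
  exact dvd_mul_right _ _

end Torsion

/-! ### Reduction of the distance to the residue field -/

section Distance

variable {c : ℤ} {n : ℕ}

/-- Multiplication by `p^(a-1)` identifies the words over the residue field with the words over
`R` which are divisible by `p^(a-1)`, and this preserves weights. -/
theorem hammingWeight_pow_mul (H : IsChainReduction p a π) (hn : n ≠ 0) (y : R[X]) :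
    hammingWeight hn (toAmbient c n ((p : R[X]) ^ (a - 1) * y))
      = hammingWeight hn (toAmbient c n (y.map π)) := by
  rw [hammingWeight, hammingWeight, AdjoinRoot.modByMonicHom_mk, AdjoinRoot.modByMonicHom_mk,
    ← map_codeModulus π, ← map_modByMonic _ (codeModulus_monic R c hn), natCast_pow_eq_C,
    ← smul_eq_C_mul, smul_modByMonic, smul_eq_C_mul, ← natCast_pow_eq_C]
  congr 1
  ext i
  rw [mem_support_iff, mem_support_iff, coeff_natCast_pow_mul, coeff_map, not_iff_not]
  refine ⟨H.eq_zero_of_pow_mul _, fun h => ?_⟩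
  obtain ⟨z, hz⟩ := (H.eq_zero_iff _).1 h
  rw [hz, ← mul_assoc, ← pow_succ, Nat.sub_add_cancel H.pos, H.pow_eq_zero, zero_mul]

/-- The annihilator of `p` consists of the multiples of `p^(a-1)`. -/
theorem pow_pred_dvd_of_p_mul_eq_zero (H : IsChainReduction p a π) {y : R[X]}
    (hy : (p : R[X]) * y = 0) : (p : R[X]) ^ (a - 1) ∣ y := by
  have key : ∀ k, k ≤ a - 1 → (p : R[X]) ^ k ∣ y := by
    intro k
    induction k with
    | zero => intro _; simp
    | succ k ih =>
      intro hk
      obtain ⟨z, rfl⟩ := ih (by omega)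
      obtain ⟨u, rfl⟩ := (H.map_eq_zero_iff _).1 (H.map_eq_zero_of_pow_mul (k := k + 1) (by omega)
        (show (p : R[X]) ^ (k + 1) * z = 0 by rw [← hy]; ring))
      exact ⟨u, by ring⟩
  exact key _ le_rfl

/-- Every nonzero code has, below each of its nonzero words, a nonzero word divisible by
`p^(a-1)`: multiply by the largest power of `p` which does not kill the word. -/
theorem exists_pow_mul_mem_of_mem (H : IsChainReduction p a π) (hn : n ≠ 0)
    {I : Ideal (CodeAmbient R c n)} {w : CodeAmbient R c n} (hw : w ∈ I) (hw0 : w ≠ 0) :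
    ∃ y : R[X], toAmbient c n ((p : R[X]) ^ (a - 1) * y) ∈ I ∧
      toAmbient c n ((p : R[X]) ^ (a - 1) * y) ≠ 0 ∧
      hammingWeight hn (toAmbient c n ((p : R[X]) ^ (a - 1) * y)) ≤ hammingWeight hn w := by
  classical
  have := H.nontrivial
  obtain ⟨f, hf, rfl⟩ := exists_toAmbient_eq hn w
  have hex : ∃ k, (p : R[X]) ^ k * f = 0 := ⟨a, by rw [H.polynomial_pow_eq_zero, zero_mul]⟩
  obtain ⟨l, hl⟩ : ∃ l, Nat.find hex = l + 1 := by
    refine Nat.exists_eq_succ_of_ne_zero fun h0 => hw0 ?_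
    have := Nat.find_spec hex
    rw [h0, pow_zero, one_mul] at this
    rw [this, toAmbient, map_zero]
  have h1 : (p : R[X]) * ((p : R[X]) ^ l * f) = 0 := by
    rw [← mul_assoc, ← pow_succ', ← hl]
    exact Nat.find_spec hex
  have h2 : (p : R[X]) ^ l * f ≠ 0 := Nat.find_min hex (by omega)
  obtain ⟨y, hy⟩ := H.pow_pred_dvd_of_p_mul_eq_zero h1
  refine ⟨y, ?_, ?_, ?_⟩
  · rw [← hy, toAmbient, map_mul]
    exact Ideal.mul_mem_left _ _ hw
  · rw [← hy, Ne, toAmbient_eq_zero_iff hn]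
    · exact h2
    · rw [natCast_pow_eq_C]
      exact (natDegree_C_mul_le _ _).trans_lt hf
  · rw [← hy]
    exact hammingWeight_natCast_pow_mul_le hn p l f

theorem codeDistance_eq_last (H : IsChainReduction p a π) (hn : n ≠ 0)
    (hg : codeModulus F c n = (X + 1) ^ n) {I : Ideal (CodeAmbient R c n)} {r : ℕ}
    {j : Fin (r + 1) → ℕ} {f : Fin (r + 1) → R[X]} (hI : IsStandardGeneratingSet p a I r j f) :
    codeDistance hn I = codeDistance hn
      (Ideal.span {toAmbient c n ((p : R[X]) ^ (a - 1) * f (Fin.last r))}) := by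
  have hle : Ideal.span {toAmbient c n ((p : R[X]) ^ (a - 1) * f (Fin.last r))} ≤ I := by
    rw [Ideal.span_singleton_le_iff_mem,
      show a - 1 = (a - 1 - j (Fin.last r)) + j (Fin.last r) by
        have := hI.j_le (Fin.last r)
        omega,
      pow_add, mul_assoc, toAmbient, map_mul]
    refine Ideal.mul_mem_left _ _ ?_
    rw [hI.span_eq]
    exact Ideal.subset_span ⟨Fin.last r, rfl⟩
  refine codeDistance_congr hn hn (fun w hw hw0 => ?_) fun v hv hv0 => ⟨v, hle hv, hv0, le_rfl⟩
  obtain ⟨y, h1, h2, h3⟩ := H.exists_pow_mul_mem_of_mem hn hw hw0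
  exact ⟨_, H.toAmbient_mem_span_last hn hg hI h1, h2, h3⟩

/-- The code generated by `p^(a-1) u` has the distance of the code over the residue field
generated by the reduction of `u`. -/
theorem codeDistance_span_pow_mul (H : IsChainReduction p a π) (hn : n ≠ 0) (u : R[X]) :
    codeDistance hn (Ideal.span {toAmbient c n ((p : R[X]) ^ (a - 1) * u)})
      = codeDistance hn (Ideal.span {toAmbient c n (u.map π)}) := by
  have key : ∀ y : R[X], toAmbient c n ((p : R[X]) ^ (a - 1) * u * y) = 0 ↔
      toAmbient c n (u.map π * y.map π) = 0 := fun y => by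
    rw [mul_assoc, ← hammingWeight_eq_zero_iff hn, H.hammingWeight_pow_mul,
      hammingWeight_eq_zero_iff, Polynomial.map_mul]
  refine codeDistance_congr hn hn (fun w hw hw0 => ?_) fun v hv hv0 => ?_
  · obtain ⟨y, rfl⟩ := Ideal.mem_span_singleton.1 hw
    obtain ⟨y, rfl⟩ := AdjoinRoot.mk_surjective y
    rw [← map_mul] at hw0 ⊢
    refine ⟨toAmbient c n (u.map π * y.map π), ?_, fun h => hw0 ((key y).2 h), ?_⟩
    · rw [Ideal.mem_span_singleton]
      exact map_dvd _ (dvd_mul_right _ _)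
    · rw [mul_assoc, H.hammingWeight_pow_mul, Polynomial.map_mul]
  · obtain ⟨y, rfl⟩ := Ideal.mem_span_singleton.1 hv
    obtain ⟨y, rfl⟩ := AdjoinRoot.mk_surjective y
    obtain ⟨y, rfl⟩ := H.map_surjective y
    rw [← map_mul] at hv0 ⊢
    refine ⟨toAmbient c n ((p : R[X]) ^ (a - 1) * u * y), ?_, fun h => hv0 ((key y).1 h), ?_⟩
    · rw [Ideal.mem_span_singleton]
      exact map_dvd _ (dvd_mul_right _ _)
    · rw [mul_assoc, H.hammingWeight_pow_mul, Polynomial.map_mul]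

end Distance

end IsChainReduction

/-! ### Existence of standard generating sets -/

namespace IsChainReduction

variable {R F : Type} [CommRing R] [Field F] {p a : ℕ} {π : R →+* F}

theorem isUnit_one_sub_pow_mul (H : IsChainReduction p a π) {k : ℕ} (hk : k ≠ 0) (q : R[X]) :
    IsUnit (1 - (p : R[X]) ^ k * q) := by
  refine IsNilpotent.isUnit_one_sub ⟨a, ?_⟩
  rw [mul_pow, ← pow_mul, H.polynomial_pow_eq_zero_of_le
    (Nat.le_mul_of_pos_left a (Nat.pos_of_ne_zero hk)), zero_mul]

/-- A polynomial over `R` which is nonzero modulo `p` is associated to a monic polynomial of the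
degree of its reduction. The remainder of the division by an approximate monic associate, which is
divisible by a power of `p`, gives the next approximation. -/
theorem exists_isUnit_mul_monic (H : IsChainReduction p a π) {f : R[X]} (hf : f.map π ≠ 0) :
    ∃ u : R[X], IsUnit u ∧ (u * f).Monic := by
  have key : ∀ k, ∃ u m r : R[X], IsUnit u ∧ m.Monic ∧ u * f = m + (p : R[X]) ^ (k + 1) * r := by
    intro k
    induction k with
    | zero =>
      obtain ⟨x, hx⟩ := H.surjective (f.map π).leadingCoeff⁻¹
      have hx0 : π x ≠ 0 := by rw [hx]; exact inv_ne_zero (leadingCoeff_ne_zero.2 hf)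
      have hmon : ((C x * f).map π).Monic := by
        rw [Polynomial.map_mul, map_C, hx, mul_comm]
        exact monic_mul_leadingCoeff_inv hf
      obtain ⟨m, hm, -, hmm⟩ := lifts_and_natDegree_eq_and_monic
        ((mem_lifts _).2 (H.map_surjective ((C x * f).map π))) hmon
      obtain ⟨r, hr⟩ := (H.map_eq_zero_iff (C x * f - m)).1 (by
        rw [Polynomial.map_sub, hm, sub_self])
      exact ⟨C x, m, r, (H.isUnit_of_map_ne_zero hx0).map C, hmm, by
        rw [zero_add, pow_one, ← hr]; ring⟩
    | succ k ih =>
      obtain ⟨u, m, r, hu, hm, hr⟩ := ih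
      have hdiv := modByMonic_add_div r m
      have := H.nontrivial
      refine ⟨(1 - (p : R[X]) ^ (k + 1) * (r /ₘ m)) * u, m + (p : R[X]) ^ (k + 1) * (r %ₘ m),
        -((p : R[X]) ^ k * (r /ₘ m) * r), (H.isUnit_one_sub_pow_mul k.succ_ne_zero _).mul hu,
        hm.add_of_left ?_, ?_⟩
      · refine lt_of_le_of_lt ?_ (degree_modByMonic_lt r hm)
        rw [natCast_pow_eq_C, ← smul_eq_C_mul]
        exact degree_smul_le _ _
      · rw [mul_assoc, hr]
        linear_combination -(p : R[X]) ^ (k + 1) * hdiv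
  obtain ⟨u, m, r, hu, hm, hr⟩ := key a
  refine ⟨u, hu, ?_⟩
  rwa [hr, H.polynomial_pow_eq_zero_of_le (Nat.le_succ a), zero_mul, add_zero]

/-- The polynomials `f` with `p^k f` in a given ideal which contains a monic polynomial reduce to
an ideal over the residue field, and a generator of it has a monic lift with the same property. -/
theorem exists_monic_generator (H : IsChainReduction p a π) {J : Ideal R[X]} {g : R[X]}
    (hg : g.Monic) (hgJ : g ∈ J) (k : ℕ) :
    ∃ D : R[X], D.Monic ∧ (p : R[X]) ^ k * D ∈ J ∧
      ∀ f, (p : R[X]) ^ k * f ∈ J → D.map π ∣ f.map π := by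
  let L : Ideal R[X] := Submodule.comap (LinearMap.mulLeft R[X] ((p : R[X]) ^ k)) J
  have hmem : ∀ x, x ∈ L.map (mapRingHom π) ↔ ∃ f ∈ L, f.map π = x := fun x =>
    Ideal.mem_map_iff_of_surjective (mapRingHom π) H.map_surjective
  obtain ⟨x, hx⟩ := (IsPrincipalIdealRing.principal (L.map (mapRingHom π))).principal
  obtain ⟨f, hf, rfl⟩ := (hmem x).1 (hx ▸ Submodule.mem_span_singleton_self x)
  have hdvd : ∀ h, h ∈ L → f.map π ∣ h.map π := fun h hh => by
    have := (hmem _).2 ⟨h, hh, rfl⟩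
    rw [hx] at this
    exact Ideal.mem_span_singleton.1 this
  have hf0 : f.map π ≠ 0 := by
    intro h0
    have := hdvd g (J.mul_mem_left _ hgJ)
    rw [h0, zero_dvd_iff] at this
    exact (hg.map π).ne_zero this
  obtain ⟨u, hu, hmon⟩ := H.exists_isUnit_mul_monic hf0
  refine ⟨u * f, hmon, ?_, fun h hh => ?_⟩
  · rw [mul_left_comm]
    exact J.mul_mem_left _ hf
  · have hu' : IsUnit (u.map π) := hu.map (mapRingHom π)
    rw [Polynomial.map_mul, hu'.mul_left_dvd]
    exact hdvd h hh

/-- An ideal `J` is contained in `J'` at level `k`, if at each level `l ≥ k` some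
`p^l D ∈ J ∩ J'` has a reduction dividing those of all `f` with `p^l f ∈ J`. -/
theorem mem_of_generators (H : IsChainReduction p a π) {J J' : Ideal R[X]} {k : ℕ} (hk : k ≤ a)
    (h : ∀ l, k ≤ l → l < a → ∃ D, (p : R[X]) ^ l * D ∈ J ∧ (p : R[X]) ^ l * D ∈ J' ∧
      ∀ f, (p : R[X]) ^ l * f ∈ J → D.map π ∣ f.map π) {x : R[X]}
    (hx : (p : R[X]) ^ k * x ∈ J) : (p : R[X]) ^ k * x ∈ J' := by
  induction hk using Nat.decreasingInduction generalizing x with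
  | self => rw [H.polynomial_pow_eq_zero, zero_mul]; exact zero_mem _
  | of_succ k hk ih =>
    obtain ⟨D, hDJ, hDJ', hD⟩ := h k le_rfl hk
    obtain ⟨q, hq⟩ := hD x hx
    obtain ⟨q, rfl⟩ := H.map_surjective q
    obtain ⟨z, hz⟩ := (H.map_eq_zero_iff (x - D * q)).1 (by
      rw [Polynomial.map_sub, Polynomial.map_mul, hq, sub_self])
    have h1 : (p : R[X]) ^ k * x = q * ((p : R[X]) ^ k * D) + (p : R[X]) ^ (k + 1) * z := by
      linear_combination (p : R[X]) ^ k * hz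
    have h2 : (p : R[X]) ^ (k + 1) * z ∈ J := by
      rw [show (p : R[X]) ^ (k + 1) * z = (p : R[X]) ^ k * x - q * ((p : R[X]) ^ k * D) by
        rw [h1]; ring]
      exact sub_mem hx (J.mul_mem_left _ hDJ)
    rw [h1]
    exact add_mem (J'.mul_mem_left _ hDJ') (ih (fun l hl => h l (by omega)) h2)

theorem exists_isStandardGeneratingSet (H : IsChainReduction p a π) {c : ℤ} {n : ℕ} (hn : n ≠ 0)
    {I : Ideal (CodeAmbient R c n)} (hI : I ≠ ⊥) :
    ∃ (r : ℕ) (j : Fin (r + 1) → ℕ) (f : Fin (r + 1) → R[X]),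
      IsStandardGeneratingSet p a I r j f := by
  classical
  have hnt := H.nontrivial
  set g := codeModulus R c n with hgdef
  have hg : g.Monic := codeModulus_monic R c hn
  have hgdeg : g.natDegree = n := codeModulus_natDegree c
  set J : Ideal R[X] := I.comap (AdjoinRoot.mk g) with hJ
  have hgJ : g ∈ J := by
    rw [hJ, Ideal.mem_comap, AdjoinRoot.mk_self]
    exact zero_mem _
  choose D hDm hDJ hD using H.exists_monic_generator hg hgJ
  have hanti : ∀ l k, l ≤ k → (D k).map π ∣ (D l).map π := fun l k hlk => by
    exact hD k _ (natCast_pow_mul_mem_of_le hlk (hDJ l))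
  have hdegle : ∀ {f h : R[X]}, f.Monic → h.Monic → f.map π ∣ h.map π →
      f.natDegree ≤ h.natDegree := fun {f h} hf hh hdvd => by
    rw [← hf.natDegree_map π, ← hh.natDegree_map π]
    exact natDegree_le_of_dvd hdvd (hh.map π).ne_zero
  -- Among monic polynomials of equal degree, divisibility modulo `p` is symmetric.
  have hsymm : ∀ {f h : R[X]}, f.Monic → h.Monic → f.map π ∣ h.map π →
      h.natDegree ≤ f.natDegree → h.map π ∣ f.map π := fun {f h} hf hh hdvd hle => by
    rw [← hf.natDegree_map π, ← hh.natDegree_map π] at hle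
    rw [eq_of_monic_of_dvd_of_natDegree_le (hf.map π) (hh.map π) hdvd hle]
  let S : Finset ℕ := (Finset.range a).filter fun k =>
    (D k).natDegree < n ∧ ∀ l < k, (D k).natDegree < (D l).natDegree
  have hS : ∀ k, k ∈ S ↔ k < a ∧ (D k).natDegree < n ∧
      ∀ l < k, (D k).natDegree < (D l).natDegree := fun k => by
    simp only [S, Finset.mem_filter, Finset.mem_range]
  -- The jumps of the degree already provide generators at every level.
  have hjump : ∀ k < a, (D k).natDegree < n → ∃ l ∈ S, l ≤ k ∧
      (D l).natDegree = (D k).natDegree ∧ (p : R[X]) ^ k * D l ∈ J ∧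
      ∀ f, (p : R[X]) ^ k * f ∈ J → (D l).map π ∣ f.map π := by
    intro k hka hkn
    have hex : ∃ l, (D l).natDegree = (D k).natDegree := ⟨k, rfl⟩
    have hle : Nat.find hex ≤ k := Nat.find_min' hex rfl
    have heq := Nat.find_spec hex
    refine ⟨Nat.find hex, (hS _).2 ⟨hle.trans_lt hka, by rwa [heq], fun l hl => ?_⟩, hle, heq,
      ?_, fun f hf => ?_⟩
    · refine lt_of_le_of_ne ?_ fun h => Nat.find_min hex hl (h.symm.trans heq)
      exact hdegle (hDm _) (hDm _) (hanti _ _ hl.le)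
    · exact natCast_pow_mul_mem_of_le hle (hDJ _)
    · exact (hsymm (hDm k) (hDm _) (hanti _ _ hle) heq.le).trans (hD k f hf)
  have hspan : ∀ k ∈ S, ∀ x, (p : R[X]) ^ k * x ∈ J → (p : R[X]) ^ k * x ∈
      Ideal.span ((fun l => (p : R[X]) ^ l * D l) '' {l | l ∈ S ∧ k ≤ l}) := by
    intro k hk x hx
    obtain ⟨hka, hkn, hkl⟩ := (hS k).1 hk
    refine H.mem_of_generators hka.le (fun k' hkk' hk'a => ?_) hx
    have hle := hdegle (hDm _) (hDm _) (hanti _ _ hkk')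
    obtain ⟨l, hlS, hlk', hdeg, h1, h2⟩ := hjump k' hk'a (hle.trans_lt hkn)
    refine ⟨D l, h1, ?_, h2⟩
    have hkl' : k ≤ l := by
      by_contra hlt
      have := hkl l (by omega)
      omega
    exact natCast_pow_mul_mem_of_le hlk' (Ideal.subset_span ⟨l, ⟨hlS, hkl'⟩, rfl⟩)
  have hspan₀ : ∀ x ∈ J, x ∈
      Ideal.span ((fun l => (p : R[X]) ^ l * D l) '' {l | l ∈ S}) ⊔ Ideal.span {g} := by
    intro x hx
    have := H.mem_of_generators (J := J) (J' := Ideal.span ((fun l => (p : R[X]) ^ l * D l) ''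
      {l | l ∈ S}) ⊔ Ideal.span {g}) (Nat.zero_le a) (fun k _ hka => ?_) (x := x)
      (by simpa using hx)
    · simpa using this
    · by_cases hkn : (D k).natDegree < n
      · obtain ⟨l, hlS, hlk, hdeg, h1, h2⟩ := hjump k hka hkn
        refine ⟨D l, h1, Ideal.mem_sup_left ?_, h2⟩
        exact natCast_pow_mul_mem_of_le hlk (Ideal.subset_span ⟨l, hlS, rfl⟩)
      · refine ⟨g, J.mul_mem_left _ hgJ, Ideal.mem_sup_right (Ideal.mul_mem_left _ _
          (Ideal.mem_span_singleton_self g)), fun f hf => ?_⟩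
        refine (hsymm (hDm k) hg (hD k g (J.mul_mem_left _ hgJ)) ?_).trans (hD k f hf)
        omega
  have hne : S.Nonempty := by
    by_contra hemp
    rw [Finset.not_nonempty_iff_eq_empty] at hemp
    refine hI ((Submodule.eq_bot_iff _).2 fun w hw => ?_)
    obtain ⟨x, rfl⟩ := AdjoinRoot.mk_surjective w
    have := hspan₀ x hw
    rw [hemp] at this
    simp only [Finset.notMem_empty, Set.ofPred_false, Set.image_empty, Ideal.span_empty,
      bot_sup_eq, Ideal.mem_span_singleton] at this
    exact AdjoinRoot.mk_eq_zero.2 this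
  obtain ⟨r, hr⟩ : ∃ r, S.card = r + 1 :=
    Nat.exists_eq_succ_of_ne_zero (Finset.card_pos.2 hne).ne'
  set j := S.orderEmbOfFin hr with hj
  have hjS : ∀ i, j i ∈ S := fun i => Finset.orderEmbOfFin_mem S hr i
  have hjsurj : ∀ l ∈ S, ∃ i, j i = l := fun l hl => by
    have : l ∈ Set.range j := by rw [hj, Finset.range_orderEmbOfFin]; exact hl
    exact this
  have htail : ∀ i, {l | l ∈ S ∧ j i ≤ l} = j '' Set.Ici i := fun i => by
    ext l
    constructor
    · rintro ⟨hl, hle⟩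
      obtain ⟨k, rfl⟩ := hjsurj l hl
      exact ⟨k, j.le_iff_le.1 hle, rfl⟩
    · rintro ⟨k, hk, rfl⟩
      exact ⟨hjS k, j.le_iff_le.2 hk⟩
  have hspan' : ∀ i x, (p : R[X]) ^ j i * x ∈ J → (p : R[X]) ^ j i * x ∈
      Ideal.span ((fun k => (p : R[X]) ^ j k * D (j k)) '' Set.Ici i) := fun i x hx => by
    have := hspan (j i) (hjS i) x hx
    rwa [htail, Set.image_image] at this
  refine ⟨r, j, fun i => D (j i), ?_, ?_, j.strictMono, fun i => ?_, fun i => hDm _, fun i => ?_,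
    fun i k hik => ?_, fun i => ?_, ?_⟩
  · have : S.card ≤ a := by simpa using Finset.card_filter_le (Finset.range a) _
    omega
  · apply le_antisymm
    · intro w hw
      obtain ⟨x, rfl⟩ := AdjoinRoot.mk_surjective w
      have h1 := Ideal.mem_map_of_mem (AdjoinRoot.mk g) (hspan₀ x hw)
      rw [Ideal.map_sup, Ideal.map_span, Ideal.map_span, Set.image_singleton, AdjoinRoot.mk_self,
        Ideal.span_singleton_eq_bot.2 rfl, sup_bot_eq] at h1
      refine Ideal.span_mono ?_ h1
      rintro _ ⟨_, ⟨l, hl, rfl⟩, rfl⟩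
      obtain ⟨i, rfl⟩ := hjsurj l hl
      exact ⟨i, rfl⟩
    · rw [Ideal.span_le]
      rintro _ ⟨i, rfl⟩
      exact hDJ (j i)
  · have := ((hS _).1 (hjS i)).1
    omega
  · exact ((hS _).1 (hjS i)).2.1
  · exact ((hS _).1 (hjS k)).2.2 _ (j.strictMono hik)
  · have hlt : j i.castSucc < j i.succ := j.strictMono Fin.castSucc_lt_succ
    have h1 := hspan' i.succ (D (j i.castSucc)) (natCast_pow_mul_mem_of_le hlt.le (hDJ _))
    have h2 := Ideal.mem_map_of_mem (AdjoinRoot.mk g) h1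
    rwa [Ideal.map_span, Set.image_image] at h2
  · have h1 := hspan' 0 g (J.mul_mem_left _ hgJ)
    rwa [show Set.Ici (0 : Fin (r + 1)) = Set.univ from Set.Ici_bot, Set.image_univ] at h1

end IsChainReduction

/-! ### The Teichmüller set -/

section Teichmuller

variable {R F : Type} [CommRing R] [Field F] {p : ℕ} {π : R →+* F}

theorem zero_mem_teichmullerSet {m : ℕ} {ζ : R} (hζ : IsPrimitiveRoot ζ (p ^ m - 1)) :
    (0 : R) ∈ teichmullerSet R p m :=
  ⟨ζ, hζ, Or.inl rfl⟩

theorem one_mem_teichmullerSet [hp : Fact p.Prime] {m : ℕ} (hm : m ≠ 0) {ζ : R}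
    (hζ : IsPrimitiveRoot ζ (p ^ m - 1)) : (1 : R) ∈ teichmullerSet R p m := by
  refine ⟨ζ, hζ, Or.inr ⟨0, ?_, (pow_zero ζ).symm⟩⟩
  have := Nat.one_lt_pow hm hp.out.one_lt
  omega

theorem map_ne_zero_of_mem_teichmullerSet {m : ℕ} {b : R} (hb : b ∈ teichmullerSet R p m)
    (hb0 : b ≠ 0) : π b ≠ 0 := by
  obtain ⟨ζ, hζ, rfl | ⟨k, hk, rfl⟩⟩ := hb
  · exact absurd rfl hb0
  · exact (((hζ.isUnit (by omega)).pow k).map π).ne_zero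

end Teichmuller

namespace IsChainReduction

variable {R F : Type} [CommRing R] [Field F] {p a : ℕ} {π : R →+* F}

/-- If `u` lifts a generator of the multiplicative group of the residue field, then `u^(p^a)` is a
primitive root of unity: raising to the power `p^a` kills the units congruent to `1` modulo `p`,
and it permutes the residue field. -/
theorem exists_isPrimitiveRoot (H : IsChainReduction p a π) [hp : Fact p.Prime] {m : ℕ} [Finite F]
    (hm : m ≠ 0) (hcard : Nat.card F = p ^ m) : ∃ ζ : R, IsPrimitiveRoot ζ (p ^ m - 1) := by
  obtain ⟨x, hx⟩ := IsCyclic.exists_generator (α := Fˣ)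
  have hord : orderOf x = p ^ m - 1 := by
    rw [orderOf_eq_card_of_forall_mem_zpowers hx, Nat.card_units, hcard]
  obtain ⟨u, hu⟩ := H.surjective (x : F)
  have hcop : (p ^ m - 1).Coprime (p ^ a) := by
    refine Nat.Coprime.pow_right a ?_
    rw [Nat.coprime_comm, hp.out.coprime_iff_not_dvd]
    intro hdvd
    have h1 : 1 ≤ p ^ m := Nat.one_le_pow _ _ hp.out.pos
    have h2 := (Nat.dvd_sub_iff_right h1 (dvd_pow_self p hm)).1 hdvd
    exact hp.out.one_lt.ne' (Nat.dvd_one.1 h2)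
  refine ⟨u ^ p ^ a, ?_, fun l hl => ?_⟩
  · have h1 : (p : R) ∣ u ^ (p ^ m - 1) - 1 := by
      rw [← H.eq_zero_iff, map_sub, map_pow, hu, map_one, ← Units.val_pow_eq_pow_val, ← hord,
        pow_orderOf_eq_one, Units.val_one, sub_self]
    have h2 := dvd_sub_pow_of_dvd_sub h1 a
    rw [pow_succ, H.pow_eq_zero, zero_mul, zero_dvd_iff, one_pow, sub_eq_zero] at h2
    rw [← pow_mul, mul_comm, pow_mul, h2]
  · have h1 : x ^ (p ^ a * l) = 1 := by
      ext
      rw [Units.val_pow_eq_pow_val, ← hu, ← map_pow, pow_mul, hl, map_one, Units.val_one]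
    rw [← orderOf_dvd_iff_pow_eq_one, hord] at h1
    exact hcop.dvd_of_dvd_mul_left h1

/-! ### Canonical forms and unit expansions -/

section CanonicalForm

variable {c : ℤ} {n : ℕ}

/-- Modulo `p` the code ambient is the chain ring `F[x]/⟨(x+1)^n⟩`, whose nonzero elements are
powers of `x + 1` times units. -/
theorem exists_eq_pow_mul_unit_add (H : IsChainReduction p a π) (hn : n ≠ 0)
    (hg : codeModulus F c n = (X + 1) ^ n) (w : CodeAmbient R c n) :
    (∃ y : CodeAmbient R c n, w = toAmbient c n (p : R[X]) * y) ∨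
      ∃ e < n, ∃ α y : CodeAmbient R c n, IsUnit α ∧ w
        = toAmbient c n ((X + 1) ^ e) * α + toAmbient c n (p : R[X]) * y := by
  have := H.nontrivial
  obtain ⟨f, hf, rfl⟩ := exists_toAmbient_eq hn w
  by_cases hf0 : f.map π = 0
  · left
    obtain ⟨y, rfl⟩ := (H.map_eq_zero_iff _).1 hf0
    exact ⟨toAmbient c n y, map_mul _ _ _⟩
  · right
    obtain ⟨u, hu, hndvd⟩ := exists_eq_pow_rootMultiplicity_mul_and_not_dvd (f.map π) hf0 (-1)
    set e := (f.map π).rootMultiplicity (-1) with he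
    have hen : e < n := by
      have h1 := natDegree_le_of_dvd (pow_rootMultiplicity_dvd (f.map π) (-1)) hf0
      rw [natDegree_pow, natDegree_X_sub_C, mul_one, ← he] at h1
      exact h1.trans_lt (natDegree_map_le.trans_lt hf)
    obtain ⟨v, rfl⟩ := H.map_surjective u
    obtain ⟨y, hy⟩ := (H.map_eq_zero_iff (f - (X + 1) ^ e * v)).1 (by
      rw [Polynomial.map_sub, hu]
      simp)
    refine ⟨e, hen, toAmbient c n v, toAmbient c n y, H.isUnit_toAmbient hg ?_, ?_⟩
    · rwa [dvd_iff_isRoot] at hndvd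
    · rw [← map_mul, ← map_mul, ← map_add, ← hy]
      congr 1
      ring

/-- Every element of the code ambient has a canonical form, with all coefficients equal to `0` or
`1`. In the step from `p^k` to `p^(k+1)` a new term is either appended, or absorbed into the unit
of an earlier term with a smaller exponent. -/
theorem exists_isCanonicalForm (H : IsChainReduction p a π) (hn : n ≠ 0)
    (hg : codeModulus F c n = (X + 1) ^ n) {m : ℕ} (h0 : (0 : R) ∈ teichmullerSet R p m)
    (h1 : (1 : R) ∈ teichmullerSet R p m) (w : CodeAmbient R c n) :
    ∃ (β : ℕ → R) (e : ℕ → ℕ) (α : ℕ → CodeAmbient R c n), IsCanonicalForm p a m w β e α := by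
  have hpa : toAmbient c n (p : R[X]) ^ a = 0 := by
    rw [← map_pow, H.polynomial_pow_eq_zero, map_zero]
  have key : ∀ K, ∃ (β : ℕ → R) (e : ℕ → ℕ) (α : ℕ → CodeAmbient R c n) (y : CodeAmbient R c n),
      (∀ k, β k = 0 ∨ β k = 1) ∧ (∀ k, K ≤ k → β k = 0) ∧ (∀ k, IsUnit (α k)) ∧ (∀ k, e k < n) ∧
      (∀ k l, k < l → β k ≠ 0 → β l ≠ 0 → e l < e k) ∧
      w = ∑ k ∈ Finset.range K, toAmbient c n (C (β k) * (p : R[X]) ^ k * (X + 1) ^ e k) * α k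
        + toAmbient c n (p : R[X]) ^ K * y := by
    intro K
    induction K with
    | zero =>
      exact ⟨0, 0, 1, w, by simp, by simp, by simp, fun _ => Nat.pos_of_ne_zero hn, by simp,
        by simp⟩
    | succ K ih =>
      obtain ⟨β, e, α, y, hβ, hβK, hα, he, hanti, hw⟩ := ih
      rcases H.exists_eq_pow_mul_unit_add hn hg y with ⟨y', hy⟩ | ⟨e', he', α', y', hα', hy⟩
      · refine ⟨β, e, α, y', hβ, fun k hk => hβK k (by omega), hα, he, hanti, ?_⟩
        rw [Finset.sum_range_succ, hβK K le_rfl, hw, hy]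
        simp only [map_zero, zero_mul]
        ring
      · by_cases hex : ∃ l < K, β l ≠ 0 ∧ e l ≤ e'
        · obtain ⟨l, hl, hβl, hle⟩ := hex
          -- Absorb the new term into the `l`-th one, whose unit changes by the nilpotent `δ`.
          set δ : CodeAmbient R c n :=
            toAmbient c n ((p : R[X]) ^ (K - l) * (X + 1) ^ (e' - e l)) * α' with hδ
          have hδnil : IsNilpotent δ := by
            rw [hδ, toAmbient_mul, mul_assoc, toAmbient_pow]
            exact (Commute.all _ _).isNilpotent_mul_right
              (IsNilpotent.pow_of_pos ⟨a, hpa⟩ (by omega))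
          refine ⟨β, e, fun k => α k + if k = l then δ else 0, y', hβ, fun k hk => hβK k (by omega),
            fun k => ?_, he, hanti, ?_⟩
          · dsimp only
            split_ifs
            · exact hδnil.isUnit_add_left_of_commute (hα k) (Commute.all _ _)
            · simpa using hα k
          · have hδ' : toAmbient c n (C (β l) * (p : R[X]) ^ l * (X + 1) ^ e l) * δ
                = toAmbient c n (p : R[X]) ^ K * (toAmbient c n ((X + 1) ^ e') * α') := by
              rw [(hβ l).resolve_left hβl, hδ, ← mul_assoc, ← mul_assoc, ← map_mul, ← map_pow,
                ← map_mul, C_1, one_mul]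
              congr 2
              conv_rhs => rw [← Nat.add_sub_cancel' hl.le, ← Nat.add_sub_cancel' hle]
              ring
            have hsum : ∑ k ∈ Finset.range K,
                toAmbient c n (C (β k) * (p : R[X]) ^ k * (X + 1) ^ e k) *
                  (α k + if k = l then δ else 0)
                = ∑ k ∈ Finset.range K,
                  toAmbient c n (C (β k) * (p : R[X]) ^ k * (X + 1) ^ e k) * α k
                  + toAmbient c n (p : R[X]) ^ K * (toAmbient c n ((X + 1) ^ e') * α') := by
              simp only [mul_add, mul_ite, mul_zero, Finset.sum_add_distrib]
              rw [Finset.sum_ite_eq' (Finset.range K) l, if_pos (Finset.mem_range.2 hl), hδ']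
            rw [Finset.sum_range_succ, hsum, hβK K le_rfl, hw, hy]
            simp only [map_zero, zero_mul]
            ring
        · -- All earlier exponents are larger, so the new term can be appended.
          push Not at hex
          have hupd : ∀ k, k ≠ K → Function.update β K 1 k = β k := fun k hk =>
            Function.update_of_ne hk _ _
          refine ⟨Function.update β K 1, Function.update e K e', Function.update α K α', y',
            fun k => ?_, fun k hk => ?_, fun k => ?_, fun k => ?_, fun k l hkl hk hl => ?_, ?_⟩
          · rcases eq_or_ne k K with rfl | hk
            · simp
            · rw [hupd k hk]; exact hβ k
          · rw [hupd k (by omega)]; exact hβK k (by omega)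
          · rcases eq_or_ne k K with rfl | hk
            · simpa using hα'
            · simpa [hk] using hα k
          · rcases eq_or_ne k K with rfl | hk
            · simpa using he'
            · simpa [hk] using he k
          · have hlK : l ≤ K := by
              by_contra hlt
              rw [hupd l (by omega)] at hl
              exact hl (hβK l (by omega))
            have hkK : k ≠ K := by omega
            rw [hupd k hkK] at hk
            rw [Function.update_of_ne hkK]
            rcases eq_or_ne l K with rfl | hlK'
            · rw [Function.update_self]
              exact hex k hkl hk
            · rw [hupd l hlK'] at hl
              rw [Function.update_of_ne hlK']
              exact hanti k l hkl hk hl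
          · rw [Finset.sum_range_succ, Finset.sum_congr rfl fun k hk => by
              have hkK : k ≠ K := (Finset.mem_range.1 hk).ne
              rw [hupd k hkK, Function.update_of_ne hkK, Function.update_of_ne hkK]]
            simp only [Function.update_self]
            rw [hw, hy, C_1, one_mul, toAmbient_mul, toAmbient_pow (p : R[X])]
            ring
  obtain ⟨β, e, α, y, hβ, -, hα, he, hanti, hw⟩ := key a
  refine ⟨β, e, α, ⟨⟨fun k _ => ?_, fun k _ => hα k, ?_⟩, fun k _ => he k,
    fun k l hkl _ => hanti k l hkl⟩⟩
  · rcases hβ k with h | h <;> rw [h] <;> assumption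
  · rw [hw, hpa, zero_mul, add_zero]

/-- Multiplication by `p^(a-1)` leaves only the first term of a unit expansion. -/
theorem pow_mul_unitExpansion (H : IsChainReduction p a π) {m : ℕ} {f : R[X]} {β : ℕ → R}
    {e : ℕ → ℕ} {α : ℕ → CodeAmbient R c n}
    (h : IsUnitExpansion p a m (toAmbient c n f) β e α) :
    toAmbient c n ((p : R[X]) ^ (a - 1) * f)
      = toAmbient c n ((p : R[X]) ^ (a - 1) * (X + 1) ^ e 0) * (toAmbient c n (C (β 0)) * α 0) := by
  rw [toAmbient_mul, h.eq_sum, Finset.mul_sum, Finset.sum_eq_single_of_mem 0 (by simpa using H.pos)]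
  · rw [← mul_assoc, ← mul_assoc, ← map_mul, ← map_mul]
    congr 2
    ring
  · intro k _ hk
    rw [← mul_assoc, ← map_mul, show (p : R[X]) ^ (a - 1) * (C (β k) * (p : R[X]) ^ k *
      (X + 1) ^ e k) = (p : R[X]) ^ (a - 1 + k) * (C (β k) * (X + 1) ^ e k) by ring,
      H.polynomial_pow_eq_zero_of_le (by omega), zero_mul, map_zero, zero_mul]

/-- The first term of a unit expansion of a monic polynomial of degree less than `n` is nonzero
modulo `p`, so its coefficient is a unit and its exponent is less than `n`. -/
theorem unitExpansion_leading (H : IsChainReduction p a π) (hn : n ≠ 0)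
    (hg : codeModulus F c n = (X + 1) ^ n) {m : ℕ} {f : R[X]} (hf : f.Monic)
    (hdeg : f.natDegree < n) {β : ℕ → R} {e : ℕ → ℕ} {α : ℕ → CodeAmbient R c n}
    (h : IsUnitExpansion p a m (toAmbient c n f) β e α) :
    β 0 ≠ 0 ∧ e 0 < n ∧ Ideal.span {toAmbient c n ((p : R[X]) ^ (a - 1) * f)}
      = Ideal.span {toAmbient c n ((p : R[X]) ^ (a - 1) * (X + 1) ^ e 0)} := by
  have hnt := H.nontrivial
  have hmul := H.pow_mul_unitExpansion h
  have hne : toAmbient c n ((p : R[X]) ^ (a - 1) * f) ≠ 0 := by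
    rw [Ne, ← hammingWeight_eq_zero_iff hn, H.hammingWeight_pow_mul,
      hammingWeight_toAmbient hn (by rwa [hf.natDegree_map]), Finset.card_eq_zero,
      support_eq_empty]
    exact (hf.map π).ne_zero
  have hβ : β 0 ≠ 0 := fun h0 => hne (by rw [hmul, h0]; simp)
  refine ⟨hβ, ?_, ?_⟩
  · by_contra hlt
    refine hne ?_
    have h1 : toAmbient c n ((p : R[X]) ^ (a - 1) * (X + 1) ^ e 0) = 0 := by
      rw [← hammingWeight_eq_zero_iff hn, H.hammingWeight_pow_mul, hammingWeight_eq_zero_iff,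
        AdjoinRoot.mk_eq_zero, hg]
      simpa using pow_dvd_pow (X + 1 : F[X]) (not_lt.1 hlt)
    rw [hmul, h1, zero_mul]
  · have hunit : IsUnit (toAmbient c n (C (β 0)) * α 0) :=
      (((H.isUnit_of_map_ne_zero (map_ne_zero_of_mem_teichmullerSet
        (h.mem_teichmuller 0 H.pos) hβ)).map C).map (AdjoinRoot.mk _)).mul (h.isUnit 0 H.pos)
    rw [hmul]
    exact Ideal.span_singleton_mul_right_unit hunit _

end CanonicalForm

/-! ### Galois rings -/

theorem comp_equiv (H : IsChainReduction p a π) {F' : Type} [Field F'] (φ : F ≃+* F') :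
    IsChainReduction p a ((φ : F →+* F').comp π) where
  pos := H.pos
  surjective := φ.surjective.comp H.surjective
  eq_zero_iff x := by simp [← H.eq_zero_iff]
  pow_eq_zero := H.pow_eq_zero
  eq_zero_of_pow_mul x hx := by simp [H.eq_zero_of_pow_mul x hx]

/-- Adjoining a root of a monic polynomial which is irreducible modulo `p` to a chain ring with
maximal ideal `(p)` gives another one. -/
theorem adjoinRoot (H : IsChainReduction p a π) {h : R[X]} (hh : h.Monic)
    [Fact (Irreducible (h.map π))] :
    IsChainReduction p a (AdjoinRoot.map π h (h.map π) dvd_rfl) := by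
  have hmk : ∀ f : R[X], AdjoinRoot.map π h (h.map π) dvd_rfl (AdjoinRoot.mk h f)
      = AdjoinRoot.mk (h.map π) (f.map π) := fun f => by
    induction f using Polynomial.induction_on' with
    | add f g hf hg => rw [map_add, map_add, hf, hg, Polynomial.map_add, map_add]
    | monomial k b => simp [← C_mul_X_pow_eq_monomial]
  have hpow : ∀ k f, (p : AdjoinRoot h) ^ k * AdjoinRoot.mk h f
      = AdjoinRoot.mk h ((p : R[X]) ^ k * f) := fun k f => by simp
  refine ⟨H.pos, fun y => ?_, fun x => ?_, ?_, fun x hx => ?_⟩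
  · obtain ⟨y, rfl⟩ := AdjoinRoot.mk_surjective y
    obtain ⟨y, rfl⟩ := H.map_surjective y
    exact ⟨_, hmk y⟩
  · obtain ⟨f, rfl⟩ := AdjoinRoot.mk_surjective x
    rw [hmk, AdjoinRoot.mk_eq_zero]
    constructor
    · rintro ⟨q, hq⟩
      obtain ⟨q, rfl⟩ := H.map_surjective q
      obtain ⟨y, hy⟩ := (H.map_eq_zero_iff (f - h * q)).1 (by
        rw [Polynomial.map_sub, Polynomial.map_mul, hq, sub_self])
      refine ⟨AdjoinRoot.mk h y, ?_⟩
      rw [sub_eq_iff_eq_add] at hy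
      rw [hy]
      simp
    · rintro ⟨y, hy⟩
      obtain ⟨y, rfl⟩ := AdjoinRoot.mk_surjective y
      rw [← AdjoinRoot.mk_eq_zero, ← hmk, hy, map_mul, hmk]
      rw [map_natCast, ← map_natCast (algebraMap F (AdjoinRoot (h.map π))), H.natCast_eq_zero,
        map_zero, zero_mul]
  · have := hpow a 1
    rw [H.polynomial_pow_eq_zero, zero_mul, map_zero, map_one, mul_one] at this
    exact this
  · obtain ⟨f, rfl⟩ := AdjoinRoot.mk_surjective x
    rw [hpow, AdjoinRoot.mk_eq_zero] at hx
    obtain ⟨q, hq⟩ := hx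
    obtain ⟨q', rfl⟩ := H.pow_dvd_of_monic hh (b := q) (by rw [mul_comm, ← hq])
    have h1 : (f - h * q').map π = 0 := by
      refine H.map_eq_zero_of_pow_mul (k := a - 1) (by have := H.pos; omega) ?_
      rw [mul_sub, hq]
      ring
    rw [hmk, AdjoinRoot.mk_eq_zero]
    rw [Polynomial.map_sub, Polynomial.map_mul, sub_eq_zero] at h1
    rw [h1]
    exact dvd_mul_right _ _

end IsChainReduction

theorem isChainReduction_zmod {p a : ℕ} [hp : Fact p.Prime] (ha : a ≠ 0) :
    IsChainReduction p a (ZMod.castHom (dvd_pow_self p ha) (ZMod p)) := by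
  have hpa : NeZero (p ^ a) := ⟨pow_ne_zero a hp.out.ne_zero⟩
  have hdvd : ∀ k : ℕ, ZMod.castHom (dvd_pow_self p ha) (ZMod p) (k : ZMod (p ^ a)) = 0 ↔ p ∣ k :=
    fun k => by rw [map_natCast, ZMod.natCast_eq_zero_iff]
  refine ⟨Nat.pos_of_ne_zero ha, ZMod.castHom_surjective _, fun x => ?_, ?_, fun x hx => ?_⟩
  · constructor
    · intro h
      obtain ⟨k, rfl⟩ := ZMod.natCast_zmod_surjective x
      obtain ⟨l, rfl⟩ := (hdvd k).1 h
      exact ⟨l, by push_cast; rfl⟩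
    · rintro ⟨y, rfl⟩
      rw [map_mul, map_natCast, ZMod.natCast_self, zero_mul]
  · rw [← Nat.cast_pow, ZMod.natCast_self]
  · obtain ⟨k, rfl⟩ := ZMod.natCast_zmod_surjective x
    rw [hdvd]
    rw [← Nat.cast_pow, ← Nat.cast_mul, ZMod.natCast_eq_zero_iff] at hx
    obtain ⟨b, rfl⟩ := Nat.exists_eq_succ_of_ne_zero ha
    rw [Nat.succ_sub_one, Nat.succ_eq_add_one, pow_succ] at hx
    exact (Nat.mul_dvd_mul_iff_left (pow_pos hp.out.pos b)).1 hx

theorem exists_isChainReduction_galoisRing {p a m : ℕ} [hp : Fact p.Prime] (ha : a ≠ 0)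
    {h : (ZMod (p ^ a))[X]} (hh : IsBasicIrreducible p a ha h) (hm : h.natDegree = m) :
    m ≠ 0 ∧ ∃ π : GaloisRing p a h →+* GaloisField p m, IsChainReduction p a π := by
  have H := isChainReduction_zmod (p := p) ha
  have hnt := H.nontrivial
  set ρ := ZMod.castHom (dvd_pow_self p ha) (ZMod p)
  have hfact : Fact (Irreducible (h.map ρ)) := ⟨hh.irreducible_reduction⟩
  have hdeg : (h.map ρ).natDegree = m := by rw [hh.monic.natDegree_map, hm]
  have hm0 : m ≠ 0 := hdeg ▸ (hfact.out.natDegree_pos).ne'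
  let B := AdjoinRoot.powerBasis hfact.out.ne_zero
  have hfin : Module.Finite (ZMod p) (AdjoinRoot (h.map ρ)) := B.finite
  have : Finite (AdjoinRoot (h.map ρ)) := Module.finite_of_finite (ZMod p)
  have hcard : Nat.card (AdjoinRoot (h.map ρ)) = p ^ m := by
    rw [Module.natCard_eq_pow_finrank (K := ZMod p), B.finrank, AdjoinRoot.powerBasis_dim, hdeg,
      Nat.card_zmod]
  exact ⟨hm0, _, (H.adjoinRoot hh.monic).comp_equiv
    (GaloisField.algEquivGaloisField p m hcard).toRingEquiv⟩

theorem codeModulus_eq_X_add_one_pow {F : Type} [Field F] {p : ℕ} [hp : Fact p.Prime] [CharP F p]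
    {c : ℤ} (hc : (p ≠ 2 ∧ c = -1) ∨ (p = 2 ∧ c = 1)) (s : ℕ) :
    codeModulus F c (p ^ s) = (X + 1) ^ p ^ s := by
  rw [add_pow_char_pow, one_pow, codeModulus]
  rcases hc with ⟨-, rfl⟩ | ⟨rfl, rfl⟩
  · simp
  · rw [Int.cast_one, C_1, CharTwo.sub_eq_add]

theorem mainTheorem7 (p a m s : ℕ) [hp : Fact p.Prime] (ha : 1 < a) (hs : 0 < s)
    (c : ℤ) (hc : (p ≠ 2 ∧ c = -1) ∨ (p = 2 ∧ c = 1))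
    (h : (ZMod (p ^ a))[X]) (hh : IsBasicIrreducible p a (Nat.ne_zero_of_lt ha) h)
    (hm : h.natDegree = m)
    (I : Ideal (CodeAmbient (GaloisRing p a h) c (p ^ s))) :
    (I ≠ ⊥ → ∃ (r : ℕ) (j : Fin (r + 1) → ℕ) (f : Fin (r + 1) → (GaloisRing p a h)[X]),
      IsStandardGeneratingSet p a I r j f) ∧
    ∀ (r : ℕ) (j : Fin (r + 1) → ℕ) (f : Fin (r + 1) → (GaloisRing p a h)[X]),
      IsStandardGeneratingSet p a I r j f →
      (∃ (β : ℕ → GaloisRing p a h) (e : ℕ → ℕ)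
          (α : ℕ → CodeAmbient (GaloisRing p a h) c (p ^ s)),
        IsCanonicalForm p a m (toAmbient c (p ^ s) (f (Fin.last r))) β e α) ∧
      ∀ (β : ℕ → GaloisRing p a h) (e : ℕ → ℕ)
          (α : ℕ → CodeAmbient (GaloisRing p a h) c (p ^ s)),
        IsUnitExpansion p a m (toAmbient c (p ^ s) (f (Fin.last r))) β e α →
        β 0 ≠ 0 ∧ e 0 < p ^ s ∧
        codeDistance (pow_ne_zero s hp.out.ne_zero) I =
          codeDistance (pow_ne_zero s hp.out.ne_zero)
            (Ideal.span {toAmbient c (p ^ s)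
              ((p : (GaloisRing p a h)[X]) ^ (a - 1) * f (Fin.last r))}) ∧
        codeDistance (pow_ne_zero s hp.out.ne_zero) I =
          codeDistance (pow_ne_zero s hp.out.ne_zero)
            (Ideal.span {toAmbient c (p ^ s)
              ((p : (GaloisRing p a h)[X]) ^ (a - 1) * (X + 1) ^ e 0)}) ∧
        codeDistance (pow_ne_zero s hp.out.ne_zero) I =
          codeDistance (pow_ne_zero s hp.out.ne_zero)
            (Ideal.span {toAmbient c (p ^ s) ((X + 1 : (GaloisField p m)[X]) ^ e 0)}) ∧
        DinhDistance p s (e 0) (codeDistance (pow_ne_zero s hp.out.ne_zero) I) := by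
  obtain ⟨hm0, π, H⟩ := exists_isChainReduction_galoisRing (Nat.ne_zero_of_lt ha) hh hm
  have hn : p ^ s ≠ 0 := pow_ne_zero s hp.out.ne_zero
  have hg := codeModulus_eq_X_add_one_pow (F := GaloisField p m) hc s
  refine ⟨fun hI => H.exists_isStandardGeneratingSet hn hI, fun r j f hI => ⟨?_, ?_⟩⟩
  · obtain ⟨ζ, hζ⟩ := H.exists_isPrimitiveRoot hm0 (GaloisField.card p m hm0)
    exact H.exists_isCanonicalForm hn hg (zero_mem_teichmullerSet hζ)
      (one_mem_teichmullerSet hm0 hζ) _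
  · intro β e α hexp
    obtain ⟨hβ, he, hspan⟩ := H.unitExpansion_leading hn hg (hI.monic _) (hI.natDegree_lt _) hexp
    have h1 := H.codeDistance_eq_last hn hg hI
    have h2 := h1.trans (congrArg (codeDistance hn) hspan)
    have h3 := h2.trans (H.codeDistance_span_pow_mul hn ((X + 1) ^ e 0))
    rw [Polynomial.map_pow, Polynomial.map_add, map_X, Polynomial.map_one] at h3
    refine ⟨hβ, he, h1, h2, h3, ?_⟩
    rw [h3]
    exact dinhDistance_codeDistance hn c hg he
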